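/- **Theorem 1.** Let $\Omega\subset\mathbb R^N$ ($N\ge 1$) be a bounded domain of class $C^1$ with outward unit normal $\eta$. Let $a_i,b_i,\sigma>0$ and $c,p_i,q_i,r_i\ge 0$ ($i=1,2,3$), and let $\varphi_1,\varphi_2,\varphi_3\in C(\overline\Omega)$ be positive on $\overline\Omega$. Consider the system $$ \begin{aligned} \partial_t u-a_1\Delta u&=\sigma-b_1u+\frac{u^{p_1}}{v^{q_1}(w^{r_1}+c)},\\ \partial_t v-a_2\Delta v&=-b_2v+\frac{u^{p_2}}{v^{q_2}w^{r_2}},\\ \partial_t w-a_3\Delta w&=-b_3w+\frac{u^{p_3}}{v^{q_3}w^{r_3}}, \end{aligned} \qquad x\in\Omega,\ t>0, $$ with boundary conditions $\frac{\partial u}{\partial\eta}=\frac{\partial v}{\partial\eta}=\frac{\partial w}{\partial\eta}=0$ on $\partial\Omega$ for $t>0$, and initial data $(u,v,w)(0,\cdot)=(\varphi_1,\varphi_2,\varphi_3)$. Assume $$ 0<p_1-1<\max\Big\{p_2\min\Big(\frac{q_1}{q_2+1},\frac{r_1}{r_2},1\Big),\ p_3\min\Big(\frac{r_1}{r_3+1},\frac{q_1}{q_3},1\Big)\Big\},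 $$ where a quotient $r_1/r_2$ or $q_1/q_3$ with zero denominator is read as $+\infty$. Put $A_{ij}=\frac{a_i+a_j}{2\sqrt{a_ia_j}}$ and let $\alpha,\beta,\gamma>0$ satisfy $$ \alpha>2\max\Big\{1,\frac{b_2+b_3}{b_1}\Big\},\qquad \frac1\beta>2A_{12}^2, $$ $$ \Big(\frac1{2\beta}-A_{12}^2\Big)\Big(\frac1{2\gamma}-A_{13}^2\Big)>\Big(\frac{\alpha-1}{\alpha}A_{23}-A_{12}A_{13}\Big)^2 . $$ A positive classical solution on $[0,T_{\max})$, $0<T_{\max}\le\infty$, is a triple $(u,v,w)$, positive on $[0,T_{\max})\times\Omega$, that satisfies the above, each component being in $C([0,T_{\max})\times\overline\Omega)\cap C^{1,2}((0,T_{\max})\times\Omega)$ with spatial gradient extending continuously to $(0,T_{\max})\times\overline\Omega$. For such a solution let $$ L(t)=\int_\Omega \frac{u(t,x)^\alpha}{v(t,x)^\beta\,w(t,x)^\gamma}\,dx . $$ Then for every real $T^*$ there is a constant $\kappa$, depending only on $\Omega$, the coefficients and exponents, the initial data and $T^*$, such that for every positive classical solution on any interval $[0,T_{\max})$ and every $t$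 with $0\le t\le T^*$ and $t<T_{\max}$, the integral $L(t)$ converges and $0\le L(t)\le\kappa$. In particular $L$ is uniformly bounded on $[0,T^*]$ for every $T^*<T_{\max}$, and if $T_{\max}<\infty$ (for example a finite blow-up time), then $L$ is bounded on all of $[0,T_{\max})$. -/

import Mathlib

open Set MeasureTheory

noncomputable section

namespace GiererMeinhardt

/-- `ρ` is a `C¹` defining function of `Ω` on the open set `U`: it has no critical point in `U`
and `Ω ∩ U = {x ∈ U | ρ x < 0}`. -/
structure IsLocalDefiningFunction {N : ℕ} (Ω U : Set (EuclideanSpace ℝ (Fin N)))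
    (ρ : EuclideanSpace ℝ (Fin N) → ℝ) : Prop where
  isOpen : IsOpen U
  contDiffOn : ContDiffOn ℝ 1 ρ U
  gradient_ne_zero : ∀ x ∈ U, gradient ρ x ≠ 0
  mem_iff : ∀ x ∈ U, (x ∈ Ω ↔ ρ x < 0)

/-- A bounded domain (nonempty connected open set) of class `C¹` in `ℝᴺ`. -/
structure IsBoundedC1Domain {N : ℕ} (Ω : Set (EuclideanSpace ℝ (Fin N))) : Prop where
  isOpen : IsOpen Ω
  isConnected : IsConnected Ω
  isBounded : Bornology.IsBounded Ω
  boundary : ∀ x ∈ frontier Ω, ∃ U ρ, x ∈ U ∧ IsLocalDefiningFunction Ω U ρ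

/-- `η` is the outward unit normal to `∂Ω` at the boundary point `x`. -/
def IsOutwardUnitNormal {N : ℕ} (Ω : Set (EuclideanSpace ℝ (Fin N)))
    (x η : EuclideanSpace ℝ (Fin N)) : Prop :=
  x ∈ frontier Ω ∧ ∃ U ρ, x ∈ U ∧ IsLocalDefiningFunction Ω U ρ ∧
    η = ‖gradient ρ x‖⁻¹ • gradient ρ x

/-- The regularity of one component of a classical solution on `[0, T) × Ω`, `T ∈ (0, ∞]`:
`z ∈ C([0, T) × closure Ω) ∩ C^{1,2}((0, T) × Ω)`. -/
structure IsClassicalRegular {N : ℕ} (Ω : Set (EuclideanSpace ℝ (Fin N))) (T : EReal)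
    (z : ℝ → EuclideanSpace ℝ (Fin N) → ℝ) : Prop where
  continuousOn : ContinuousOn (fun y : ℝ × EuclideanSpace ℝ (Fin N) => z y.1 y.2)
    ({t : ℝ | 0 ≤ t ∧ (t : EReal) < T} ×ˢ closure Ω)
  differentiable_time : ∀ t : ℝ, 0 < t → (t : EReal) < T → ∀ x ∈ Ω,
    DifferentiableAt ℝ (fun s => z s x) t
  continuousOn_time : ContinuousOn
    (fun y : ℝ × EuclideanSpace ℝ (Fin N) => deriv (fun s => z s y.2) y.1)
    ({t : ℝ | 0 < t ∧ (t : EReal) < T} ×ˢ Ω)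
  contDiffOn_space : ∀ t : ℝ, 0 < t → (t : EReal) < T → ContDiffOn ℝ 2 (z t) Ω
  continuousOn_space : ContinuousOn
    (fun y : ℝ × EuclideanSpace ℝ (Fin N) => iteratedFDeriv ℝ 2 (z y.1) y.2)
    ({t : ℝ | 0 < t ∧ (t : EReal) < T} ×ˢ Ω)

/-- The homogeneous Neumann condition `∂z/∂η = 0` on `(0, T) × ∂Ω`: the spatial gradient of `z`
extends continuously to `(0, T) × closure Ω`, and the extension is orthogonal to the outward normal
on `∂Ω`. -/
def SatisfiesNeumann {N : ℕ} (Ω : Set (EuclideanSpace ℝ (Fin N))) (T : EReal)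
    (z : ℝ → EuclideanSpace ℝ (Fin N) → ℝ) : Prop :=
  ∃ G : ℝ → EuclideanSpace ℝ (Fin N) → EuclideanSpace ℝ (Fin N),
    ContinuousOn (fun y : ℝ × EuclideanSpace ℝ (Fin N) => G y.1 y.2)
      ({t : ℝ | 0 < t ∧ (t : EReal) < T} ×ˢ closure Ω) ∧
    ∀ t : ℝ, 0 < t → (t : EReal) < T →
      (∀ x ∈ Ω, G t x = gradient (z t) x) ∧
      ∀ x η, IsOutwardUnitNormal Ω x η → inner ℝ (G t x) η = 0

/-- The coefficients and exponents of the three-component Gierer–Meinhardt system. -/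
structure Params where
  (a₁ a₂ a₃ b₁ b₂ b₃ σ c : ℝ)
  (p₁ p₂ p₃ q₁ q₂ q₃ r₁ r₂ r₃ : ℝ)

namespace Params

/-- Sign conditions: `aᵢ, bᵢ, σ > 0` and `c, pᵢ, qᵢ, rᵢ ≥ 0`. -/
structure Admissible (P : Params) : Prop where
  a_pos : 0 < P.a₁ ∧ 0 < P.a₂ ∧ 0 < P.a₃
  b_pos : 0 < P.b₁ ∧ 0 < P.b₂ ∧ 0 < P.b₃
  σ_pos : 0 < P.σ
  c_nonneg : 0 ≤ P.c
  p_nonneg : 0 ≤ P.p₁ ∧ 0 ≤ P.p₂ ∧ 0 ≤ P.p₃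
  q_nonneg : 0 ≤ P.q₁ ∧ 0 ≤ P.q₂ ∧ 0 ≤ P.q₃
  r_nonneg : 0 ≤ P.r₁ ∧ 0 ≤ P.r₂ ∧ 0 ≤ P.r₃

/-- `min (x, m / n, 1)`, where `m / n` is read as `+∞` if `n = 0`. -/
def minRatio (x m n : ℝ) : ℝ :=
  if n = 0 then min x 1 else min x (min (m / n) 1)

/-- The condition on the exponents. -/
def ExponentCondition (P : Params) : Prop :=
  0 < P.p₁ - 1 ∧
  P.p₁ - 1 < max (P.p₂ * minRatio (P.q₁ / (P.q₂ + 1)) P.r₁ P.r₂)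
    (P.p₃ * minRatio (P.r₁ / (P.r₃ + 1)) P.q₁ P.q₃)

/-- The reaction terms. -/
def f (P : Params) (u v w : ℝ) : ℝ :=
  P.σ - P.b₁ * u + u ^ P.p₁ / (v ^ P.q₁ * (w ^ P.r₁ + P.c))

def g (P : Params) (u v w : ℝ) : ℝ :=
  -P.b₂ * v + u ^ P.p₂ / (v ^ P.q₂ * w ^ P.r₂)

def h (P : Params) (u v w : ℝ) : ℝ :=
  -P.b₃ * w + u ^ P.p₃ / (v ^ P.q₃ * w ^ P.r₃)

end Params

/-- `A(a, a') = (a + a') / (2 √(a a'))`. -/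
def A (a a' : ℝ) : ℝ := (a + a') / (2 * √(a * a'))

/-- The conditions on the exponents `α, β, γ` of the Lyapunov functional. -/
structure WeightCondition (P : Params) (α β γ : ℝ) : Prop where
  α_pos : 0 < α
  β_pos : 0 < β
  γ_pos : 0 < γ
  α_gt : 2 * max 1 ((P.b₂ + P.b₃) / P.b₁) < α
  β_inv_gt : 2 * A P.a₁ P.a₂ ^ 2 < 1 / β
  det_gt : ((α - 1) / α * A P.a₂ P.a₃ - A P.a₁ P.a₂ * A P.a₁ P.a₃) ^ 2 <
    (1 / (2 * β) - A P.a₁ P.a₂ ^ 2) * (1 / (2 * γ) - A P.a₁ P.a₃ ^ 2)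

/-- `(u, v, w)` is a positive classical solution on `[0, T) × Ω`, `T ∈ (0, ∞]`, of the
Gierer–Meinhardt system with homogeneous Neumann boundary conditions and initial data
`(φ₁, φ₂, φ₃)`. -/
structure IsPositiveClassicalSolution {N : ℕ} (P : Params) (Ω : Set (EuclideanSpace ℝ (Fin N)))
    (φ₁ φ₂ φ₃ : EuclideanSpace ℝ (Fin N) → ℝ) (T : EReal)
    (u v w : ℝ → EuclideanSpace ℝ (Fin N) → ℝ) : Prop where
  T_pos : 0 < T
  regular : IsClassicalRegular Ω T u ∧ IsClassicalRegular Ω T v ∧ IsClassicalRegular Ω T w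
  pos : ∀ t : ℝ, 0 ≤ t → (t : EReal) < T → ∀ x ∈ Ω, 0 < u t x ∧ 0 < v t x ∧ 0 < w t x
  eq_u : ∀ t : ℝ, 0 < t → (t : EReal) < T → ∀ x ∈ Ω,
    deriv (fun s => u s x) t - P.a₁ * Laplacian.laplacian (u t) x = P.f (u t x) (v t x) (w t x)
  eq_v : ∀ t : ℝ, 0 < t → (t : EReal) < T → ∀ x ∈ Ω,
    deriv (fun s => v s x) t - P.a₂ * Laplacian.laplacian (v t) x = P.g (u t x) (v t x) (w t x)
  eq_w : ∀ t : ℝ, 0 < t → (t : EReal) < T → ∀ x ∈ Ω,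
    deriv (fun s => w s x) t - P.a₃ * Laplacian.laplacian (w t) x = P.h (u t x) (v t x) (w t x)
  neumann : SatisfiesNeumann Ω T u ∧ SatisfiesNeumann Ω T v ∧ SatisfiesNeumann Ω T w
  initial : ∀ x ∈ Ω, u 0 x = φ₁ x ∧ v 0 x = φ₂ x ∧ w 0 x = φ₃ x

/-- The integrand `u^α / (v^β w^γ)` of the Lyapunov functional at time `t`. -/
def density {N : ℕ} (α β γ : ℝ) (u v w : ℝ → EuclideanSpace ℝ (Fin N) → ℝ) (t : ℝ)
    (x : EuclideanSpace ℝ (Fin N)) : ℝ :=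
  u t x ^ α / (v t x ^ β * w t x ^ γ)

/-- The Lyapunov functional `L(t) = ∫_Ω u^α / (v^β w^γ) dx`. -/
def L {N : ℕ} (Ω : Set (EuclideanSpace ℝ (Fin N))) (α β γ : ℝ)
    (u v w : ℝ → EuclideanSpace ℝ (Fin N) → ℝ) (t : ℝ) : ℝ :=
  ∫ x in Ω, density α β γ u v w t x

end GiererMeinhardt

end

/-!
The functional `L(t) = ∫ uᵅ v⁻ᵝ w⁻ᵞ` is controlled by differentiating its integrand `D` in time and
separating diffusion from reaction.

*Diffusion.* With the flux `F = a₁ ∂ᵤD ∇u + a₂ ∂ᵥD ∇v + a₃ ∂_wD ∇w`, the diffusive part of `∂ₜD` is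
`div F` minus `D` times a quadratic form in the logarithmic gradients `∇u/u`, `∇v/v`, `∇w/w`. The
conditions on `α, β, γ` make this form positive semidefinite (`diffusion_le_divergence`).

*Reaction.* If `v` and `w` are bounded below, the reaction part of `∂ₜD` is at most `K D + K`
(`exists_reaction_le`). The only dangerous term is the production `u^(p₁-1) / (v^q₁ (w^r₁ + c))`.
The exponent condition bounds it by a constant times `Y ^ θ`, where `θ < 1` and `Y` is one of the
two consumption terms `u^p₂ / (v^(q₂+1) w^r₂)` and `u^p₃ / (v^q₃ w^(r₃+1))`, which enter `∂ₜD` with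
a negative sign.

*Boundary.* The solution is `C²` only in the interior, and its second derivatives may be unbounded
near `∂Ω`, so the divergence theorem is applied in a weak form. The divergence is integrated against
a cutoff depending on the distance to the complement of `Ω`. Its gradient has size `O(1/ε)`, lives
on a collar of measure `O(ε)` (`exists_collar_bound`) and points in the direction of the normal at
a nearest boundary point (`exists_nearest_normal`), where the flux has no normal component. So the
boundary contribution vanishes as `ε → 0`, and `∂ₜD ≤ div F` implies that `∫ D` is
non-increasing (`setIntegral_le_of_deriv_le_divergence`).

The last statement is used twice: for `(m - e^{bt} z)₊³`, to bound `v` and `w` below up to the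
boundary (`IsNeumannRegular.mul_exp_le`), and for `e^{-Kt} uᵅ v⁻ᵝ w⁻ᵞ - Kt`, which gives the
Gronwall estimate for `L` (`setIntegral_weighted_le`).
-/

open Set MeasureTheory

noncomputable section

namespace GiererMeinhardt

open Filter Topology Metric

variable {N : ℕ} {Ω : Set (EuclideanSpace ℝ (Fin N))}

/-! ### Nearest boundary points, normals and collars -/

/-- A nonzero functional that is nonpositive on an open half-space is a negative multiple of the
inner normal of that half-space. -/
theorem inv_norm_smul_eq_of_inner_nonpos {E : Type*} [NormedAddCommGroup E]
    [InnerProductSpace ℝ E] {g n : E} (hn : n ≠ 0) (hg : g ≠ 0)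
    (h : ∀ e, 0 < inner ℝ e n → inner ℝ g e ≤ 0) : ‖g‖⁻¹ • g = ‖n‖⁻¹ • (-n) := by
  have hn2 : inner ℝ n n ≠ 0 := by simpa using hn
  have hnn : 0 < inner ℝ n n := by
    rw [real_inner_self_eq_norm_sq]; have := norm_pos_iff.2 hn; positivity
  set s : ℝ := inner ℝ g n / inner ℝ n n with hs
  set p : E := g - s • n with hp
  have hpn : inner ℝ p n = 0 := by
    rw [hp, inner_sub_left, inner_smul_left, hs]; simp only [conj_trivial]; field_simp; simp
  have hgp : inner ℝ g p = inner ℝ p p := by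
    have : g = p + s • n := by rw [hp]; abel
    have hnp : inner ℝ n p = 0 := by rw [real_inner_comm]; exact hpn
    conv_lhs => rw [this, inner_add_left, inner_smul_left, hnp]
    simp
  have hgn : inner ℝ g n ≤ 0 := h n hnn
  have hle : ∀ δ : ℝ, 0 < δ → inner ℝ p p + δ * inner ℝ g n ≤ 0 := by
    intro δ hδ
    have := h (p + δ • n) (by
      rw [inner_add_left, hpn, inner_smul_left]; simp only [conj_trivial]; positivity)
    rwa [inner_add_right, inner_smul_right, hgp] at this
  have hpp : inner ℝ p p ≤ 0 := by
    refine le_of_tendsto (f := fun δ : ℝ => inner ℝ p p + δ * inner ℝ g n) (x := 𝓝[>] 0) ?_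
      (eventually_mem_nhdsWithin.mono fun δ hδ => hle δ hδ)
    have : Tendsto (fun δ : ℝ => inner ℝ p p + δ * inner ℝ g n) (𝓝 0)
        (𝓝 (inner ℝ p p + 0 * inner ℝ g n)) := by
      apply Continuous.tendsto; fun_prop
    simpa using this.mono_left nhdsWithin_le_nhds
  have hp0 : p = 0 := by
    rw [real_inner_self_eq_norm_sq] at hpp
    have : ‖p‖ = 0 := by nlinarith [norm_nonneg p]
    simpa using this
  have hgs : g = s • n := by rw [hp, sub_eq_zero] at hp0; exact hp0
  have hs0 : s < 0 := by
    rcases lt_or_eq_of_le (div_nonpos_of_nonpos_of_nonneg hgn hnn.le) with h1 | h1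
    · exact h1
    · exact absurd (by rw [hgs, hs, h1, zero_smul]) hg
  rw [hgs, norm_smul, Real.norm_eq_abs, abs_of_neg hs0, smul_smul, smul_neg, ← neg_smul]
  congr 1
  have : ‖n‖ ≠ 0 := norm_ne_zero_iff.2 hn
  have := hs0.ne
  field_simp

theorem exists_nearest_compl (hΩ : IsOpen Ω) (hne : Ωᶜ.Nonempty) {x : EuclideanSpace ℝ (Fin N)}
    (hx : x ∈ Ω) : ∃ y ∈ frontier Ω, infDist x Ωᶜ = dist x y ∧ 0 < dist x y ∧
      ball x (dist x y) ⊆ Ω := by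
  obtain ⟨y, hy, hxy⟩ := hΩ.isClosed_compl.exists_infDist_eq_dist hne x
  have hpos : 0 < dist x y := by
    rw [dist_pos]; rintro rfl; exact hy hx
  have hball : ball x (dist x y) ⊆ Ω := by
    intro z hz
    by_contra hzΩ
    have := infDist_le_dist_of_mem (x := x) (show z ∈ Ωᶜ from hzΩ)
    rw [mem_ball, dist_comm] at hz
    linarith
  refine ⟨y, ⟨?_, ?_⟩, hxy, hpos, hball⟩
  · apply closure_mono hball
    rw [closure_ball _ hpos.ne', mem_closedBall, dist_comm]
  · rwa [hΩ.interior_eq]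

/-- At a nearest boundary point `y` of `x ∈ Ω`, the ball around `x` through `y` touches the
boundary from inside, so the direction from `x` to `y` is the outward unit normal. -/
theorem exists_nearest_normal (hΩ : IsBoundedC1Domain Ω) (hne : Ωᶜ.Nonempty)
    {x : EuclideanSpace ℝ (Fin N)} (hx : x ∈ Ω) :
    ∃ y ∈ frontier Ω, infDist x Ωᶜ = dist x y ∧ 0 < dist x y ∧
      IsOutwardUnitNormal Ω y ((dist x y)⁻¹ • (y - x)) := by
  obtain ⟨y, hy, hxy, hpos, hball⟩ := exists_nearest_compl hΩ.isOpen hne hx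
  obtain ⟨U, ρ, hyU, hρ⟩ := hΩ.boundary y hy
  refine ⟨y, hy, hxy, hpos, hy, U, ρ, hyU, hρ, ?_⟩
  have hyΩ : y ∉ Ω := by have := hy.2; rwa [hΩ.isOpen.interior_eq] at this
  have hdiff : DifferentiableAt ℝ ρ y :=
    (hρ.contDiffOn.contDiffAt (hρ.isOpen.mem_nhds hyU)).differentiableAt one_ne_zero
  -- Directions into the touching ball lead from `ρ y ≥ 0` to `ρ < 0`.
  have key : ∀ e, 0 < inner ℝ e (x - y) → inner ℝ (gradient ρ y) e ≤ 0 := by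
    intro e he
    have hd : HasDerivAt (fun t : ℝ => ρ (y + t • e)) (inner ℝ (gradient ρ y) e) 0 := by
      have h1 : HasFDerivAt ρ (InnerProductSpace.toDual ℝ _ (gradient ρ y)) (y + (0 : ℝ) • e) := by
        simpa using hdiff.hasGradientAt.hasFDerivAt
      have h2 : HasDerivAt (fun t : ℝ => y + t • e) e 0 := by
        simpa using ((hasDerivAt_id (0 : ℝ)).smul_const e).const_add y
      have h3 := h1.comp_hasDerivAt (0 : ℝ) h2
      rwa [InnerProductSpace.toDual_apply_apply] at h3
    rw [hasDerivAt_iff_tendsto_slope] at hd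
    have hd' := hd.mono_left (nhdsWithin_mono 0 (show Ioi (0 : ℝ) ⊆ {0}ᶜ from
      fun t ht => (ne_of_gt ht)))
    refine le_of_tendsto hd' ?_
    have c1 : Continuous fun t : ℝ => y + t • e := by fun_prop
    have hU : ∀ᶠ t : ℝ in 𝓝[>] 0, y + t • e ∈ U := by
      apply nhdsWithin_le_nhds
      apply c1.continuousAt.preimage_mem_nhds
      simpa using hρ.isOpen.mem_nhds hyU
    have hsm : ∀ᶠ t : ℝ in 𝓝[>] 0, t * ‖e‖ ^ 2 < 2 * inner ℝ e (x - y) := by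
      apply nhdsWithin_le_nhds
      have : Tendsto (fun t : ℝ => t * ‖e‖ ^ 2) (𝓝 0) (𝓝 (0 * ‖e‖ ^ 2)) := by
        apply Continuous.tendsto; fun_prop
      exact this.eventually (gt_mem_nhds (by simpa using he))
    filter_upwards [hU, hsm, eventually_mem_nhdsWithin] with t htU hts ht
    have ht0 : (0 : ℝ) < t := ht
    have hin : y + t • e ∈ Ω := by
      apply hball
      rw [mem_ball, dist_comm, dist_eq_norm, dist_eq_norm]
      have : x - (y + t • e) = (x - y) - t • e := by abel
      rw [this]
      refine lt_of_pow_lt_pow_left₀ 2 (norm_nonneg _) ?_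
      rw [norm_sub_sq_real, inner_smul_right, norm_smul, real_inner_comm, mul_pow,
        Real.norm_eq_abs, sq_abs]
      nlinarith
    have h1 : ρ (y + t • e) < 0 := (hρ.mem_iff _ htU).1 hin
    have h2 : 0 ≤ ρ y := by
      by_contra h; exact hyΩ ((hρ.mem_iff _ hyU).2 (not_le.1 h))
    rw [slope_def_field]
    simp only [zero_smul, add_zero, sub_zero]
    exact div_nonpos_of_nonpos_of_nonneg (by linarith) ht0.le
  have hn : x - y ≠ 0 := by rw [sub_ne_zero]; exact dist_pos.1 hpos
  rw [inv_norm_smul_eq_of_inner_nonpos hn (hρ.gradient_ne_zero y hyU) key, dist_eq_norm]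
  simp

/-- The part of `Ω` within distance `ε` of its complement. -/
def collar (Ω : Set (EuclideanSpace ℝ (Fin N))) (ε : ℝ) : Set (EuclideanSpace ℝ (Fin N)) :=
  {x ∈ Ω | infDist x Ωᶜ ≤ ε}

theorem measurableSet_collar (hΩ : IsOpen Ω) (ε : ℝ) : MeasurableSet (collar Ω ε) :=
  hΩ.measurableSet.inter (measurableSet_le (continuous_infDist_pt _).measurable measurable_const)

/-- A bounded set that has width less than `3ε` in the direction `e` along every line has measure
`O(ε)`: about `1/ε` of its translates by multiples of `3εe` are disjoint and fit into a fixed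
ball. -/
theorem measureReal_le_of_translates {S : Set (EuclideanSpace ℝ (Fin N))} (hS : MeasurableSet S)
    {y e : EuclideanSpace ℝ (Fin N)} (he : ‖e‖ = 1) (hSy : S ⊆ ball y 1) {ε : ℝ} (hε : 0 < ε)
    (hε1 : ε ≤ 1)
    (hd : ∀ x ∈ S, ∀ s : ℝ, x + s • e ∈ S → s < 3 * ε) :
    volume.real S ≤ volume.real (ball y 7) * ε := by
  set M : ℕ := ⌈1 / ε⌉₊ with hM
  have hM1 : 1 / ε ≤ M := Nat.le_ceil _
  have hM2 : (M : ℝ) < 1 / ε + 1 := Nat.ceil_lt_add_one (by positivity)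
  have hMε : (M : ℝ) * ε ≤ 2 := by
    have : (M : ℝ) * ε ≤ (1 / ε + 1) * ε := by gcongr
    have h2 : (1 / ε + 1) * ε = 1 + ε := by field_simp
    linarith
  have hM1' : 1 ≤ M * ε := by
    have := mul_le_mul_of_nonneg_right hM1 hε.le
    rwa [one_div, inv_mul_cancel₀ hε.ne'] at this
  let T : ℕ → Set (EuclideanSpace ℝ (Fin N)) := fun k => (fun x => x + (-(3 * ε * k) : ℝ) • e) ⁻¹' S
  have hTm : ∀ k, MeasurableSet (T k) := fun k => hS.preimage (by fun_prop)
  have hTv : ∀ k, volume.real (T k) = volume.real S := fun k => by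
    simp only [T, measureReal_def]
    rw [measure_preimage_add_right]
  have hdisj : (↑(Finset.range M) : Set ℕ).PairwiseDisjoint T := by
    have aux : ∀ i j : ℕ, i < j → Disjoint (T i) (T j) := by
      intro i j hij
      rw [Set.disjoint_left]
      intro x hi hj
      have h3 := hd _ hj (3 * ε * (j - i)) (by
        have : x + (-(3 * ε * j) : ℝ) • e + (3 * ε * (j - i) : ℝ) • e
          = x + (-(3 * ε * i) : ℝ) • e := by
          rw [add_assoc, ← add_smul]; congr 2; ring
        rw [this]; exact hi)
      have h4 : (1 : ℝ) ≤ j - i := by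
        have : (i : ℝ) + 1 ≤ j := by exact_mod_cast hij
        linarith
      nlinarith
    intro i _ j _ hij
    rcases lt_or_gt_of_ne hij with h | h
    · exact aux i j h
    · exact (aux j i h).symm
  have hsub : (⋃ k ∈ Finset.range M, T k) ⊆ ball y 7 := by
    intro x hx
    simp only [mem_iUnion, Finset.mem_range] at hx
    obtain ⟨k, hk, hx⟩ := hx
    have h1 := hSy hx
    rw [mem_ball, dist_eq_norm] at h1 ⊢
    have : x - y = (x + (-(3 * ε * k) : ℝ) • e - y) + (3 * ε * k : ℝ) • e := by
      rw [neg_smul]; abel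
    rw [this]
    refine (norm_add_le _ _).trans_lt ?_
    rw [norm_smul, he, mul_one, Real.norm_eq_abs, abs_of_nonneg (by positivity)]
    have hk' : (k : ℝ) ≤ M := by exact_mod_cast hk.le
    have : 3 * ε * k ≤ 3 * (M * ε) := by nlinarith
    linarith
  have hsum : M * volume.real S ≤ volume.real (ball y 7) := by
    have h1 : volume.real (⋃ k ∈ Finset.range M, T k) = ∑ k ∈ Finset.range M, volume.real (T k) :=
      measureReal_biUnion_finset hdisj (fun k _ => hTm k)
        (fun k _ => ((measure_mono (subset_biUnion_of_mem (by assumption))).trans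
          (measure_mono hsub)).trans_lt measure_ball_lt_top |>.ne)
    rw [Finset.sum_congr rfl (fun k _ => hTv k)] at h1
    simp only [Finset.sum_const, Finset.card_range, nsmul_eq_mul] at h1
    rw [← h1]
    exact measureReal_mono hsub measure_ball_lt_top.ne
  have h0 : 0 ≤ volume.real S := measureReal_nonneg
  calc volume.real S ≤ (M * ε) * volume.real S := by nlinarith
    _ = (M * volume.real S) * ε := by ring
    _ ≤ _ := by gcongr

/-- Near a boundary point, the defining function is strictly monotone in a fixed direction with
slope comparable to its Lipschitz constant; hence the collar meets each line in that direction in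
a set of diameter `O(ε)`. -/
theorem collar_local_bound (hΩ : IsBoundedC1Domain Ω) (hne : Ωᶜ.Nonempty)
    {y : EuclideanSpace ℝ (Fin N)} (hy : y ∈ frontier Ω) :
    ∃ r > 0, ∃ C : ℝ, ∀ ε, 0 < ε → ε ≤ r →
      volume.real (ball y r ∩ collar Ω ε) ≤ C * ε := by
  obtain ⟨U, ρ, hyU, hρ⟩ := hΩ.boundary y hy
  have hU := hρ.isOpen.mem_nhds hyU
  set g := gradient ρ y with hg
  have hg0 : 0 < ‖g‖ := norm_pos_iff.2 (hρ.gradient_ne_zero y hyU)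
  have hstrict : HasStrictFDerivAt ρ (InnerProductSpace.toDual ℝ _ g) y := by
    rw [hg, toDual_gradient]
    exact (hρ.contDiffOn.contDiffAt hU).hasStrictFDerivAt one_ne_zero
  -- Precision `‖g‖ / 2` gives slope at least `‖g‖ / 2` along `g` and Lipschitz constant `3‖g‖ / 2`.
  obtain ⟨s, hs, happ⟩ := hstrict.approximates_deriv_on_nhds (c := (‖g‖₊ / 2)) (Or.inr (by
    have : 0 < ‖g‖₊ := by exact_mod_cast hg0
    positivity))
  obtain ⟨R, hR, hRsub⟩ := Metric.mem_nhds_iff.1 (inter_mem hs hU)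
  have happ' : ∀ a ∈ ball y R, ∀ b ∈ ball y R,
      |ρ a - ρ b - inner ℝ g (a - b)| ≤ ‖g‖ / 2 * ‖a - b‖ := by
    intro a ha b hb
    have := happ a (hRsub ha).1 b (hRsub hb).1
    simpa using this
  have hr0 : 0 < min (R / 2) (1 / 2) := by positivity
  refine ⟨min (R / 2) (1 / 2), hr0, volume.real (ball y 7), fun ε hε hεr => ?_⟩
  have hεR : ε ≤ R / 2 := hεr.trans (min_le_left _ _)
  have hval : ∀ x ∈ ball y (min (R / 2) (1 / 2)) ∩ collar Ω ε,
      x ∈ ball y R ∧ ρ x < 0 ∧ -(3 / 2 * ‖g‖ * ε) ≤ ρ x := by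
    rintro x ⟨hxb, hxΩ, hxε⟩
    have hxb' : dist x y < R / 2 := lt_of_lt_of_le hxb (min_le_left _ _)
    have hxR : x ∈ ball y R := by rw [mem_ball]; linarith
    refine ⟨hxR, (hρ.mem_iff x (hRsub hxR).2).1 hxΩ, ?_⟩
    obtain ⟨z, hz, hxz, -, -⟩ := exists_nearest_compl hΩ.isOpen hne hxΩ
    have hzR : z ∈ ball y R := by
      rw [mem_ball]
      have := dist_triangle z x y
      rw [dist_comm z x] at this
      linarith
    have hzΩ : z ∉ Ω := by have := hz.2; rwa [hΩ.isOpen.interior_eq] at this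
    have hz0 : 0 ≤ ρ z := by
      by_contra h; exact hzΩ ((hρ.mem_iff _ (hRsub hzR).2).2 (not_le.1 h))
    have h1 := (abs_le.1 (happ' x hxR z hzR)).1
    have h2 := (abs_le.1 (abs_real_inner_le_norm g (x - z))).1
    rw [hxz, dist_eq_norm] at hxε
    nlinarith
  refine measureReal_le_of_translates (e := ‖g‖⁻¹ • g)
    (measurableSet_ball.inter (measurableSet_collar hΩ.isOpen ε)) ?_ ?_ hε
    (by linarith [hεr.trans (min_le_right _ _)]) ?_
  · rw [norm_smul, norm_inv, norm_norm, inv_mul_cancel₀ hg0.ne']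
  · exact inter_subset_left.trans (ball_subset_ball ((min_le_right _ _).trans (by norm_num)))
  · intro x hx t hxt
    rcases le_or_gt t 0 with ht | ht
    · linarith
    obtain ⟨hxR, hx0, hxl⟩ := hval x hx
    obtain ⟨hxR', hx0', hxl'⟩ := hval _ hxt
    have h1 := (abs_le.1 (happ' _ hxR' x hxR)).1
    rw [add_sub_cancel_left, norm_smul, norm_smul, norm_inv, norm_norm, inv_mul_cancel₀ hg0.ne',
      inner_smul_right, inner_smul_right, real_inner_self_eq_norm_sq, Real.norm_eq_abs,
      abs_of_pos ht, mul_one] at h1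
    have h2 : t * (‖g‖⁻¹ * ‖g‖ ^ 2) = t * ‖g‖ := by field_simp
    rw [h2] at h1
    have h3 : ‖g‖ / 2 * t < 3 / 2 * ‖g‖ * ε := by linarith
    have h4 : ‖g‖ * t < ‖g‖ * (3 * ε) := by linarith
    exact lt_of_mul_lt_mul_left h4 hg0.le

/-- A bounded `C¹` domain has finite perimeter, in the form of a bound on the measure of its
collars. -/
theorem exists_collar_bound (hΩ : IsBoundedC1Domain Ω) (hne : Ωᶜ.Nonempty) :
    ∃ C : ℝ, ∃ ε₀ > 0, ∀ ε, 0 < ε → ε ≤ ε₀ → volume.real (collar Ω ε) ≤ C * ε := by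
  have hK : IsCompact (frontier Ω) :=
    Metric.isCompact_of_isClosed_isBounded isClosed_frontier
      (hΩ.isBounded.closure.subset frontier_subset_closure)
  choose! r hr C hC using fun y (hy : y ∈ frontier Ω) => collar_local_bound hΩ hne hy
  obtain ⟨t, htK, htcov⟩ := hK.elim_nhds_subcover (fun y => ball y (r y))
    (fun y hy => ball_mem_nhds y (hr y hy))
  obtain ⟨δ, hδ, hδsub⟩ := hK.exists_thickening_subset_open
    (isOpen_biUnion fun y _ => isOpen_ball) htcov
  obtain ⟨ε₁, hε₁, hε₁t⟩ : ∃ ε₁ > 0, ∀ y ∈ t, ε₁ ≤ r y := by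
    rcases t.eq_empty_or_nonempty with h | h
    · exact ⟨1, one_pos, by simp [h]⟩
    · exact ⟨t.inf' h r, (Finset.lt_inf'_iff h).2 fun y hy => hr y (htK y hy),
        fun y hy => Finset.inf'_le r hy⟩
  refine ⟨∑ y ∈ t, C y, min ε₁ (δ / 2), by positivity, fun ε hε hε0 => ?_⟩
  have hsub : collar Ω ε ⊆ ⋃ y ∈ t, (ball y (r y) ∩ collar Ω ε) := by
    intro x hx
    obtain ⟨z, hz, hxz, -, -⟩ := exists_nearest_compl hΩ.isOpen hne hx.1
    have hxt : x ∈ thickening δ (frontier Ω) := by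
      rw [mem_thickening_iff]
      refine ⟨z, hz, ?_⟩
      have := hx.2
      have := hε0.trans (min_le_right _ _)
      linarith
    have := hδsub hxt
    simp only [mem_iUnion] at this ⊢
    obtain ⟨y, hy, hxy⟩ := this
    exact ⟨y, hy, hxy, hx⟩
  have hfin : volume (⋃ y ∈ t, (ball y (r y) ∩ collar Ω ε)) ≠ ⊤ := by
    refine ((measure_mono ?_).trans_lt hΩ.isBounded.measure_lt_top).ne
    exact iUnion₂_subset fun y _ => inter_subset_right.trans fun x hx => hx.1
  calc volume.real (collar Ω ε) ≤ volume.real (⋃ y ∈ t, (ball y (r y) ∩ collar Ω ε)) :=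
        measureReal_mono hsub hfin
    _ ≤ ∑ y ∈ t, volume.real (ball y (r y) ∩ collar Ω ε) := measureReal_biUnion_finset_le _ _
    _ ≤ ∑ y ∈ t, C y * ε := Finset.sum_le_sum fun y hy =>
        hC y (htK y hy) ε hε ((hε0.trans (min_le_left _ _)).trans (hε₁t y hy))
    _ = _ := by rw [Finset.sum_mul]

/-! ### The divergence theorem for tangential fields -/

/-- The divergence of a vector field on `ℝᴺ`. -/
def divergence (V : EuclideanSpace ℝ (Fin N) → EuclideanSpace ℝ (Fin N))
    (x : EuclideanSpace ℝ (Fin N)) : ℝ :=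
  ∑ i, fderiv ℝ V x (EuclideanSpace.single i 1) i

theorem continuous_mul_of_tsupport_subset {X : Type*} [TopologicalSpace X] {U : Set X}
    (hU : IsOpen U) {χ g : X → ℝ} (hχ : Continuous χ) (hsub : tsupport χ ⊆ U)
    (hg : ContinuousOn g U) : Continuous fun x => χ x * g x :=
  continuous_of_tsupport fun _ hx => hχ.continuousAt.mul
    (hg.continuousAt (hU.mem_nhds (hsub (tsupport_mul_subset_left hx))))

theorem continuousOn_divergence (hΩ : IsOpen Ω)
    {V : EuclideanSpace ℝ (Fin N) → EuclideanSpace ℝ (Fin N)} (hV : ContDiffOn ℝ 1 V Ω) :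
    ContinuousOn (divergence V) Ω := by
  have h := hV.continuousOn_fderiv_of_isOpen hΩ le_rfl
  unfold divergence
  refine continuousOn_finsetSum _ fun i _ => ?_
  exact (PiLp.continuous_apply 2 _ i).comp_continuousOn (h.clm_apply continuousOn_const)

/-- Integration by parts of a vector field that is `C¹` on an open set against a Lipschitz function
with compact support in it. -/
theorem integral_mul_divergence (hΩ : IsOpen Ω) {χ : EuclideanSpace ℝ (Fin N) → ℝ} {K : NNReal}
    (hχ : LipschitzWith K χ) (hc : HasCompactSupport χ) (hsub : tsupport χ ⊆ Ω)
    {V : EuclideanSpace ℝ (Fin N) → EuclideanSpace ℝ (Fin N)} (hV : ContDiffOn ℝ 1 V Ω) :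
    ∫ x, χ x * divergence V x = -∫ x, fderiv ℝ χ x (V x) := by
  -- Cutting `V` off outside a neighbourhood of the support of `χ` makes it globally Lipschitz.
  obtain ⟨Q, hQ, hQ1, hQ2⟩ := exists_compact_between hc hΩ hsub
  obtain ⟨ψ, hψ1, hψ0, -⟩ := exists_contMDiffMap_one_nhds_of_subset_interior (n := 1)
    (modelWithCornersSelf ℝ (EuclideanSpace ℝ (Fin N))) (isClosed_tsupport χ) hQ1
  have hψ : ContDiff ℝ 1 ψ := ψ.contMDiff.contDiff
  have hψts : tsupport ψ ⊆ Q := closure_minimal (fun x hx => by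
    by_contra h; exact hx (hψ0 x h)) hQ.isClosed
  set W : EuclideanSpace ℝ (Fin N) → EuclideanSpace ℝ (Fin N) := fun x => ψ x • V x with hWdef
  have hWts : tsupport W ⊆ Q := (tsupport_smul_subset_left _ _).trans hψts
  have hW : ContDiff ℝ 1 W := contDiff_iff_contDiffAt.2 fun x => by
    by_cases hx : x ∈ Ω
    · exact hψ.contDiffAt.smul (hV.contDiffAt (hΩ.mem_nhds hx))
    · have : W =ᶠ[𝓝 x] fun _ => 0 := by
        have : (tsupport W)ᶜ ∈ 𝓝 x :=
          (isClosed_tsupport W).isOpen_compl.mem_nhds fun h => hx (hQ2 (hWts h))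
        filter_upwards [this] with z hz
        exact image_eq_zero_of_notMem_tsupport hz
      exact contDiffAt_const.congr_of_eventuallyEq this
  have hWc : HasCompactSupport W := hQ.of_isClosed_subset (isClosed_tsupport _) hWts
  have hWV : ∀ x ∈ tsupport χ, W =ᶠ[𝓝 x] V := fun x hx => by
    have := (eventually_nhdsSet_iff_forall.1 hψ1) x hx
    filter_upwards [this] with z hz
    simp [hWdef, hz]
  have hWi : ∀ i, ContDiff ℝ 1 fun x => W x i := fun i =>
    (EuclideanSpace.proj (𝕜 := ℝ) i : EuclideanSpace ℝ (Fin N) →L[ℝ] ℝ).contDiff.comp hW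
  have hWic : ∀ i, HasCompactSupport fun x => W x i := fun i =>
    hWc.comp_left (g := fun y : EuclideanSpace ℝ (Fin N) => y i) rfl
  choose C hC using fun i => (hWi i).lipschitzWith_of_hasCompactSupport (hWic i) one_ne_zero
  have hpart : ∀ i, ∫ x, lineDeriv ℝ χ x (EuclideanSpace.single i 1) * W x i =
      - ∫ x, χ x * fderiv ℝ W x (EuclideanSpace.single i 1) i := fun i => by
    rw [LipschitzWith.integral_lineDeriv_mul_eq hχ (hC i) (hWic i), ← integral_neg]
    congr 1 with x
    have h1 : HasFDerivAt (fun x => W x i)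
        ((EuclideanSpace.proj (𝕜 := ℝ) i : EuclideanSpace ℝ (Fin N) →L[ℝ] ℝ).comp
          (fderiv ℝ W x)) x :=
      (EuclideanSpace.proj (𝕜 := ℝ) i : EuclideanSpace ℝ (Fin N) →L[ℝ] ℝ).hasFDerivAt.comp x
        ((hW.differentiable one_ne_zero).differentiableAt.hasFDerivAt)
    rw [h1.differentiableAt.lineDeriv_eq_fderiv, h1.fderiv]
    simp [mul_comm]
  have hint1 : ∀ i, Integrable fun x => lineDeriv ℝ χ x (EuclideanSpace.single i 1) * W x i :=
    fun i => ((hWi i).continuous.integrable_of_hasCompactSupport (hWic i)).bdd_mul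
      (hχ.memLp_lineDeriv _).aestronglyMeasurable
      (.of_forall fun x => norm_lineDeriv_le_of_lipschitz ℝ hχ)
  have hint2 : ∀ i, Integrable fun x => χ x * fderiv ℝ W x (EuclideanSpace.single i 1) i :=
    fun i => by
      have hcont : Continuous fun x => fderiv ℝ W x (EuclideanSpace.single i 1) i :=
        (PiLp.continuous_apply 2 _ i).comp ((hW.continuous_fderiv one_ne_zero).clm_apply
          continuous_const)
      exact (hχ.continuous.mul hcont).integrable_of_hasCompactSupport hc.mul_right
  have e1 : ∫ x, χ x * divergence V x
      = ∑ i, ∫ x, χ x * fderiv ℝ W x (EuclideanSpace.single i 1) i := by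
    rw [← integral_finsetSum _ fun i _ => hint2 i]
    congr 1 with x
    rw [← Finset.mul_sum]
    by_cases hx : x ∈ tsupport χ
    · rw [(hWV x hx).fderiv_eq]; rfl
    · rw [image_eq_zero_of_notMem_tsupport hx]; simp
  have e2 : ∫ x, fderiv ℝ χ x (V x)
      = ∑ i, ∫ x, lineDeriv ℝ χ x (EuclideanSpace.single i 1) * W x i := by
    rw [← integral_finsetSum _ fun i _ => hint1 i]
    refine integral_congr_ae ?_
    filter_upwards [hχ.ae_differentiableAt] with x hd
    have h2 : ∀ i, lineDeriv ℝ χ x (EuclideanSpace.single i 1)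
        = fderiv ℝ χ x (EuclideanSpace.single i 1) := fun i => hd.lineDeriv_eq_fderiv
    simp only [h2]
    by_cases hx : x ∈ tsupport χ
    · rw [← (hWV x hx).eq_of_nhds]
      conv_lhs => rw [← (EuclideanSpace.basisFun (Fin N) ℝ).sum_repr (W x)]
      simp [mul_comm]
    · rw [fderiv_of_notMem_tsupport ℝ hx]; simp
  rw [e1, e2, ← Finset.sum_neg_distrib]
  exact Finset.sum_congr rfl fun i _ => by rw [hpart i, neg_neg]

theorem deriv_smoothTransition_eq_zero {s : ℝ} (hs : s < 0 ∨ 1 < s) :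
    deriv Real.smoothTransition s = 0 := by
  rcases hs with hs | hs
  · have : Real.smoothTransition =ᶠ[𝓝 s] fun _ => 0 := by
      filter_upwards [Iio_mem_nhds hs] with z hz
      exact Real.smoothTransition.zero_of_nonpos (le_of_lt hz)
    rw [this.deriv_eq, deriv_const]
  · have : Real.smoothTransition =ᶠ[𝓝 s] fun _ => 1 := by
      filter_upwards [Ioi_mem_nhds hs] with z hz
      exact Real.smoothTransition.one_of_one_le (le_of_lt hz)
    rw [this.deriv_eq, deriv_const]

theorem exists_deriv_smoothTransition_bound :
    ∃ K : NNReal, ∀ s, ‖deriv Real.smoothTransition s‖₊ ≤ K := by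
  have hc : Continuous (deriv Real.smoothTransition) :=
    (Real.smoothTransition.contDiff (n := 1)).continuous_deriv le_rfl
  obtain ⟨K, hK⟩ := (isCompact_Icc (a := (0 : ℝ)) (b := 1)).exists_bound_of_continuousOn
    hc.continuousOn
  refine ⟨K.toNNReal, fun s => ?_⟩
  rw [← NNReal.coe_le_coe, coe_nnnorm]
  refine le_trans ?_ (Real.le_coe_toNNReal K)
  have hK0 : 0 ≤ K := (norm_nonneg _).trans (hK 0 (by simp))
  by_cases h : s ∈ Icc (0 : ℝ) 1
  · exact hK s h
  · rw [deriv_smoothTransition_eq_zero (by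
      by_contra h'; push Not at h'; exact h h'), norm_zero]
    exact hK0

/-- A cutoff that vanishes within distance `ε` of the complement of `Ω` and equals `1` at
distance `≥ 2ε` from it. -/
def cutoff (Ω : Set (EuclideanSpace ℝ (Fin N))) (ε : ℝ) (x : EuclideanSpace ℝ (Fin N)) : ℝ :=
  Real.smoothTransition (infDist x Ωᶜ / ε - 1)

theorem cutoff_nonneg (ε : ℝ) (x : EuclideanSpace ℝ (Fin N)) : 0 ≤ cutoff Ω ε x :=
  Real.smoothTransition.nonneg _

theorem cutoff_le_one (ε : ℝ) (x : EuclideanSpace ℝ (Fin N)) : cutoff Ω ε x ≤ 1 :=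
  Real.smoothTransition.le_one _

theorem continuous_cutoff (ε : ℝ) : Continuous (cutoff Ω ε) :=
  Real.smoothTransition.continuous.comp
    (((continuous_infDist_pt _).div_const _).sub continuous_const)

theorem tsupport_cutoff_subset {ε : ℝ} (hε : 0 < ε) : tsupport (cutoff Ω ε) ⊆ Ω := by
  have h1 : tsupport (cutoff Ω ε) ⊆ {x | ε ≤ infDist x Ωᶜ} := by
    refine closure_minimal (fun x hx => ?_)
      (isClosed_le continuous_const (continuous_infDist_pt _))
    by_contra h
    refine hx (Real.smoothTransition.zero_of_nonpos ?_)
    have : infDist x Ωᶜ / ε ≤ 1 := (div_le_one hε).2 (not_le.1 h).le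
    linarith
  intro x hx
  by_contra hxΩ
  have := h1 hx
  rw [mem_ofPred_eq, infDist_zero_of_mem (show x ∈ Ωᶜ from hxΩ)] at this
  linarith

theorem hasCompactSupport_cutoff (hb : Bornology.IsBounded Ω) {ε : ℝ} (hε : 0 < ε) :
    HasCompactSupport (cutoff Ω ε) :=
  Metric.isCompact_of_isClosed_isBounded (isClosed_tsupport _)
    (hb.subset (tsupport_cutoff_subset hε))

theorem exists_lipschitzWith_cutoff (ε : ℝ) : ∃ K, LipschitzWith K (cutoff Ω ε) := by
  obtain ⟨K, hK⟩ := exists_deriv_smoothTransition_bound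
  have h1 : LipschitzWith K Real.smoothTransition := lipschitzWith_of_nnnorm_deriv_le
    ((Real.smoothTransition.contDiff (n := 1)).differentiable one_ne_zero) hK
  have h2 : LipschitzWith ‖ε⁻¹‖₊ fun d : ℝ => d / ε - 1 :=
    LipschitzWith.of_dist_le_mul fun a b => by
      rw [Real.dist_eq, Real.dist_eq, coe_nnnorm, Real.norm_eq_abs, ← abs_mul]
      apply le_of_eq; congr 1; ring
  exact ⟨_, h1.comp (h2.comp (lipschitz_infDist_pt Ωᶜ))⟩

theorem tendsto_cutoff (hΩ : IsOpen Ω) (hne : Ωᶜ.Nonempty) {x : EuclideanSpace ℝ (Fin N)}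
    (hx : x ∈ Ω) : Tendsto (fun ε => cutoff Ω ε x) (𝓝[>] 0) (𝓝 1) := by
  have hpos : 0 < infDist x Ωᶜ :=
    (hΩ.isClosed_compl.notMem_iff_infDist_pos hne).1 (by simpa using hx)
  apply tendsto_const_nhds.congr'
  have : ∀ᶠ ε : ℝ in 𝓝[>] 0, ε < infDist x Ωᶜ / 2 :=
    nhdsWithin_le_nhds (Iio_mem_nhds (by positivity))
  filter_upwards [this, eventually_mem_nhdsWithin] with ε h1 h2
  have h2' : (0 : ℝ) < ε := h2
  refine (Real.smoothTransition.one_of_one_le ?_).symm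
  have : 2 ≤ infDist x Ωᶜ / ε := by rw [le_div_iff₀ h2']; linarith
  linarith

/-- Where the distance to the complement is differentiable, its gradient is the unit vector pointing
away from any nearest point. -/
theorem fderiv_infDist_apply {x y : EuclideanSpace ℝ (Fin N)} {s : Set (EuclideanSpace ℝ (Fin N))}
    (hd : DifferentiableAt ℝ (fun z => infDist z s) x) (hy : y ∈ closure s)
    (hxy : infDist x s = dist x y) (hpos : 0 < dist x y) (v : EuclideanSpace ℝ (Fin N)) :
    fderiv ℝ (fun z => infDist z s) x v = - inner ℝ v ((dist x y)⁻¹ • (y - x)) := by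
  have hne : x - y ≠ 0 := sub_ne_zero.2 (dist_pos.1 hpos)
  -- `dist z y ^ 2 - infDist z s ^ 2` is nonnegative and vanishes at `z = x`.
  have h1 : HasFDerivAt (fun z => dist z y ^ 2 - infDist z s ^ 2)
      ((2 : ℝ) • (innerSL ℝ (x - y))
        - (2 * infDist x s) • fderiv ℝ (fun z => infDist z s) x) x := by
    have a1 : HasFDerivAt (fun z => dist z y ^ 2) ((2 : ℝ) • (innerSL ℝ (x - y))) x := by
      simp only [dist_eq_norm]
      have := (((hasFDerivAt_id (𝕜 := ℝ) x).sub_const y)).norm_sq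
      simpa [two_smul] using this
    have a2 := hd.hasFDerivAt.pow 2
    refine a1.sub ?_
    simpa using a2
  have hmin : IsLocalMin (fun z => dist z y ^ 2 - infDist z s ^ 2) x := by
    refine Eventually.of_forall fun z => ?_
    simp only [hxy, sub_self]
    have : infDist z s ≤ dist z y := by
      rw [← infDist_closure]; exact infDist_le_dist_of_mem hy
    have := pow_le_pow_left₀ infDist_nonneg this 2
    linarith
  have h0 := hmin.hasFDerivAt_eq_zero h1
  have h2 := DFunLike.congr_fun h0 v
  simp only [_root_.sub_apply, _root_.smul_apply, innerSL_apply_apply,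
    smul_eq_mul, _root_.zero_apply, hxy] at h2
  rw [inner_smul_right, ← neg_sub x y, inner_neg_right, real_inner_comm]
  field_simp
  linarith

/-- The Neumann form of the divergence theorem. A field tangent to the boundary has
`∫ cutoff · div V = -∫ V · ∇cutoff`, where `∇cutoff` has size `O(1/ε)`, lives on the collar of
measure `O(ε)` and points along the normal at the nearest boundary point, where `V` has no normal
component. So the integral is controlled by the oscillation of `V` at scale `2ε`. -/
theorem exists_integral_cutoff_mul_divergence_bound (hΩ : IsBoundedC1Domain Ω)
    (hne : Ωᶜ.Nonempty) :
    ∃ C : ℝ, ∃ ε₀ > 0, ∀ ε, 0 < ε → ε ≤ ε₀ →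
      ∀ (V : EuclideanSpace ℝ (Fin N) → EuclideanSpace ℝ (Fin N)) (ω : ℝ), 0 ≤ ω →
        ContDiffOn ℝ 1 V Ω → (∀ y η, IsOutwardUnitNormal Ω y η → inner ℝ (V y) η = 0) →
        (∀ x ∈ Ω, ∀ y ∈ frontier Ω, dist x y ≤ 2 * ε → ‖V x - V y‖ ≤ ω) →
        |∫ x, cutoff Ω ε x * divergence V x| ≤ C * ω := by
  obtain ⟨C, ε₀, hε₀, hC⟩ := exists_collar_bound hΩ hne
  obtain ⟨K, hK⟩ := exists_deriv_smoothTransition_bound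
  refine ⟨2 * C * K, ε₀ / 2, by positivity, fun ε hε hεε V ω hω hV hn hosc => ?_⟩
  obtain ⟨L, hL⟩ := exists_lipschitzWith_cutoff (Ω := Ω) ε
  rw [integral_mul_divergence hΩ.isOpen hL (hasCompactSupport_cutoff hΩ.isBounded hε)
    (tsupport_cutoff_subset hε) hV, abs_neg]
  have hmeas := measurableSet_collar hΩ.isOpen (2 * ε)
  have hfin : volume (collar Ω (2 * ε)) < ⊤ :=
    (measure_mono (fun x hx => hx.1)).trans_lt hΩ.isBounded.measure_lt_top
  have hbound : ∀ᵐ x, ‖fderiv ℝ (cutoff Ω ε) x (V x)‖ ≤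
      (collar Ω (2 * ε)).indicator (fun _ => K / ε * ω) x := by
    filter_upwards [(lipschitz_infDist_pt (Ωᶜ)).ae_differentiableAt (μ := volume)] with x hd
    by_cases hxΩ : x ∈ Ω
    · obtain ⟨y, hy, hxy, hpos, hnorm⟩ := exists_nearest_normal hΩ hne hxΩ
      have hyc : y ∈ closure Ωᶜ := by
        rw [closure_compl]; exact hy.2
      have hs : HasFDerivAt (cutoff Ω ε)
          ((deriv Real.smoothTransition (infDist x Ωᶜ / ε - 1)) •
            (ε⁻¹ • fderiv ℝ (fun z => infDist z Ωᶜ) x)) x := by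
        have h1 : HasFDerivAt (fun z => infDist z Ωᶜ / ε - 1)
            (ε⁻¹ • fderiv ℝ (fun z => infDist z Ωᶜ) x) x := by
          simpa [div_eq_inv_mul] using (hd.hasFDerivAt.const_mul ε⁻¹).sub_const 1
        exact (((Real.smoothTransition.contDiff (n := 1)).differentiable
          one_ne_zero).differentiableAt.hasDerivAt).comp_hasFDerivAt x h1
      rw [hs.fderiv]
      simp only [_root_.smul_apply, smul_eq_mul,
        fderiv_infDist_apply hd hyc hxy hpos]
      by_cases hxc : x ∈ collar Ω (2 * ε)
      · rw [indicator_of_mem hxc]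
        have h1 : ‖V x - V y‖ ≤ ω := hosc x hxΩ y hy (hxy ▸ hxc.2)
        have h2 : |inner ℝ (V x) ((dist x y)⁻¹ • (y - x))| ≤ ω := by
          have e : inner ℝ (V x) ((dist x y)⁻¹ • (y - x))
              = inner ℝ (V x - V y) ((dist x y)⁻¹ • (y - x)) := by
            rw [inner_sub_left, hn y _ hnorm, sub_zero]
          rw [e]
          refine (abs_real_inner_le_norm _ _).trans ?_
          have : ‖(dist x y)⁻¹ • (y - x)‖ = 1 := by
            rw [norm_smul, norm_inv, ← dist_eq_norm, dist_comm y x, Real.norm_of_nonneg hpos.le,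
              inv_mul_cancel₀ hpos.ne']
          rw [this, mul_one]; exact h1
        have h3 : ‖deriv Real.smoothTransition (infDist x Ωᶜ / ε - 1)‖ ≤ K := by
          exact_mod_cast hK (infDist x Ωᶜ / ε - 1)
        rw [norm_mul, norm_mul, norm_neg, norm_inv, Real.norm_of_nonneg hε.le]
        have h4 : (K : ℝ) / ε * ω = K * (ε⁻¹ * ω) := by ring
        rw [h4]
        gcongr
        exact h2
      · rw [indicator_of_notMem hxc]
        have h1 : 2 * ε < infDist x Ωᶜ := by
          by_contra h; exact hxc ⟨hxΩ, not_lt.1 h⟩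
        rw [deriv_smoothTransition_eq_zero (Or.inr (by
          have : 2 < infDist x Ωᶜ / ε := by rw [lt_div_iff₀ hε]; exact h1
          linarith))]
        simp
    · rw [fderiv_of_notMem_tsupport ℝ (fun h => hxΩ (tsupport_cutoff_subset hε h))]
      simp only [_root_.zero_apply, norm_zero]
      exact indicator_nonneg (fun _ _ => by positivity) _
  refine (norm_integral_le_of_norm_le
    ((integrableOn_const hfin.ne).integrable_indicator hmeas) hbound).trans ?_
  rw [integral_indicator hmeas, setIntegral_const, smul_eq_mul]
  calc volume.real (collar Ω (2 * ε)) * (K / ε * ω) ≤ C * (2 * ε) * (K / ε * ω) := by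
        gcongr
        exact hC _ (by positivity) (by linarith)
    _ = _ := by field_simp

theorem continuousOn_slice {X Y Z : Type*} [TopologicalSpace X] [TopologicalSpace Y]
    [TopologicalSpace Z] {f : X → Y → Z} {s : Set X} {t : Set Y}
    (hf : ContinuousOn (fun p : X × Y => f p.1 p.2) (s ×ˢ t)) {x : X} (hx : x ∈ s) :
    ContinuousOn (f x) t :=
  hf.comp (f := fun y => (x, y)) (by fun_prop) fun _ hy => ⟨hx, hy⟩

theorem continuousOn_slice_left {X Y Z : Type*} [TopologicalSpace X] [TopologicalSpace Y]
    [TopologicalSpace Z] {f : X → Y → Z} {s : Set X} {t : Set Y}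
    (hf : ContinuousOn (fun p : X × Y => f p.1 p.2) (s ×ˢ t)) {y : Y} (hy : y ∈ t) :
    ContinuousOn (fun x => f x y) s :=
  hf.comp (f := fun x => (x, y)) (by fun_prop) fun _ hx => ⟨hx, hy⟩

theorem integrableOn_of_continuousOn_closure (hb : Bornology.IsBounded Ω)
    {f : EuclideanSpace ℝ (Fin N) → ℝ} (hf : ContinuousOn f (closure Ω)) : IntegrableOn f Ω :=
  (hf.integrableOn_compact (Metric.isCompact_of_isClosed_isBounded isClosed_closure
    hb.closure)).mono_set subset_closure

theorem hasDerivAt_integral_cutoff_mul (hΩ : IsOpen Ω) (hb : Bornology.IsBounded Ω) {t₁ : ℝ}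
    {D D' : ℝ → EuclideanSpace ℝ (Fin N) → ℝ}
    (hDs : ∀ t ∈ Ioo 0 t₁, ContinuousOn (D t) Ω)
    (hD : ∀ t ∈ Ioo 0 t₁, ∀ x ∈ Ω, HasDerivAt (fun s => D s x) (D' t x) t)
    (hD' : ContinuousOn (fun p : ℝ × EuclideanSpace ℝ (Fin N) => D' p.1 p.2) (Ioo 0 t₁ ×ˢ Ω))
    {ε : ℝ} (hε : 0 < ε) {t : ℝ} (ht : t ∈ Ioo 0 t₁) :
    HasDerivAt (fun s => ∫ x, cutoff Ω ε x * D s x) (∫ x, cutoff Ω ε x * D' t x) t := by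
  have hsub := tsupport_cutoff_subset (Ω := Ω) hε
  have hcs := hasCompactSupport_cutoff hb hε
  obtain ⟨r, hr, hrsub⟩ := Metric.nhds_basis_closedBall.mem_iff.1 (isOpen_Ioo.mem_nhds ht)
  obtain ⟨M, hM⟩ := ((isCompact_closedBall t r).prod hcs).exists_bound_of_continuousOn
    (hD'.mono (prod_mono hrsub hsub))
  have hcont : ∀ s ∈ Ioo 0 t₁, Continuous fun x => cutoff Ω ε x * D s x := fun s hs =>
    continuous_mul_of_tsupport_subset hΩ (continuous_cutoff ε) hsub (hDs s hs)
  refine (hasDerivAt_integral_of_dominated_loc_of_deriv_le (𝕜 := ℝ)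
    (F := fun s x => cutoff Ω ε x * D s x) (F' := fun s x => cutoff Ω ε x * D' s x)
    (bound := fun x => cutoff Ω ε x * M) (closedBall_mem_nhds t hr)
    ?_ ?_ ?_ ?_ ?_ ?_).2
  · filter_upwards [isOpen_Ioo.mem_nhds ht] with s hs using (hcont s hs).aestronglyMeasurable
  · exact (hcont t ht).integrable_of_hasCompactSupport hcs.mul_right
  · exact (continuous_mul_of_tsupport_subset hΩ (continuous_cutoff ε) hsub
      (continuousOn_slice hD' ht)).aestronglyMeasurable
  · refine .of_forall fun x s hs => ?_
    by_cases hx : x ∈ tsupport (cutoff Ω ε)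
    · rw [norm_mul, Real.norm_of_nonneg (cutoff_nonneg _ _)]
      exact mul_le_mul_of_nonneg_left (hM (s, x) ⟨hs, hx⟩) (cutoff_nonneg _ _)
    · simp [image_eq_zero_of_notMem_tsupport hx]
  · exact ((continuous_cutoff ε).mul continuous_const).integrable_of_hasCompactSupport hcs.mul_right
  · refine Eventually.of_forall fun x s hs => ?_
    by_cases hx : x ∈ tsupport (cutoff Ω ε)
    · exact (hD s (hrsub hs) x (hsub hx)).const_mul _
    · simpa [image_eq_zero_of_notMem_tsupport hx] using hasDerivAt_const (𝕜 := ℝ) s (0 : ℝ)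

theorem tendsto_integral_cutoff_mul (hΩ : IsOpen Ω) (hb : Bornology.IsBounded Ω)
    (hne : Ωᶜ.Nonempty) {f : EuclideanSpace ℝ (Fin N) → ℝ} (hf : ContinuousOn f (closure Ω)) :
    Tendsto (fun ε => ∫ x, cutoff Ω ε x * f x) (𝓝[>] 0) (𝓝 (∫ x in Ω, f x)) := by
  have hint := integrableOn_of_continuousOn_closure hb hf
  have h1 : Tendsto (fun ε => ∫ x in Ω, cutoff Ω ε x * f x) (𝓝[>] 0) (𝓝 (∫ x in Ω, f x)) := by
    refine tendsto_integral_filter_of_dominated_convergence (fun x => ‖f x‖) ?_ ?_ hint.norm ?_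
    · exact .of_forall fun ε => (continuous_cutoff ε).aestronglyMeasurable.mul
        hint.aestronglyMeasurable
    · refine .of_forall fun ε => .of_forall fun x => ?_
      rw [norm_mul, Real.norm_of_nonneg (cutoff_nonneg _ _)]
      exact mul_le_of_le_one_left (norm_nonneg _) (cutoff_le_one _ _)
    · refine (ae_restrict_iff' hΩ.measurableSet).2 (.of_forall fun x hx => ?_)
      simpa using (tendsto_cutoff hΩ hne hx).mul_const (f x)
  refine h1.congr' ?_
  filter_upwards [eventually_mem_nhdsWithin] with ε hε
  refine setIntegral_eq_integral_of_forall_compl_eq_zero fun x hx => ?_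
  rw [image_eq_zero_of_notMem_tsupport fun h => hx (tsupport_cutoff_subset hε h), zero_mul]

theorem continuousOn_setIntegral (hb : Bornology.IsBounded Ω) (hΩ : MeasurableSet Ω) {t₁ : ℝ}
    {D : ℝ → EuclideanSpace ℝ (Fin N) → ℝ}
    (hD : ContinuousOn (fun p : ℝ × EuclideanSpace ℝ (Fin N) => D p.1 p.2)
      (Icc 0 t₁ ×ˢ closure Ω)) :
    ContinuousOn (fun t => ∫ x in Ω, D t x) (Icc 0 t₁) := by
  obtain ⟨M, hM⟩ := (isCompact_Icc.prod (Metric.isCompact_of_isClosed_isBounded isClosed_closure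
    hb.closure)).exists_bound_of_continuousOn hD
  refine continuousOn_of_dominated (bound := fun _ => M) ?_ ?_ ?_ ?_
  · intro t ht
    have := continuousOn_slice hD ht
    exact (integrableOn_of_continuousOn_closure hb this).aestronglyMeasurable
  · exact fun t ht => (ae_restrict_iff' hΩ).2 (.of_forall fun x hx =>
      hM (t, x) ⟨ht, subset_closure hx⟩)
  · exact integrableOn_const hb.measure_lt_top.ne
  · exact (ae_restrict_iff' hΩ).2 (.of_forall fun x hx =>
      continuousOn_slice_left hD (subset_closure hx))

/-- A density that obeys `∂ₜD ≤ div F` in the interior, with a flux `F` tangent to the boundary, has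
non-increasing integral. The derivatives need not be controlled near the boundary of `Ω`
or near the end points of the time interval. -/
theorem setIntegral_le_of_deriv_le_divergence (hΩ : IsBoundedC1Domain Ω) (hne : Ωᶜ.Nonempty)
    {t₁ : ℝ} (ht₁ : 0 < t₁) {D D' : ℝ → EuclideanSpace ℝ (Fin N) → ℝ}
    {F : ℝ → EuclideanSpace ℝ (Fin N) → EuclideanSpace ℝ (Fin N)}
    (hDc : ContinuousOn (fun p : ℝ × EuclideanSpace ℝ (Fin N) => D p.1 p.2)
      (Icc 0 t₁ ×ˢ closure Ω))
    (hD : ∀ t ∈ Ioo 0 t₁, ∀ x ∈ Ω, HasDerivAt (fun s => D s x) (D' t x) t)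
    (hD' : ContinuousOn (fun p : ℝ × EuclideanSpace ℝ (Fin N) => D' p.1 p.2) (Ioo 0 t₁ ×ˢ Ω))
    (hFc : ContinuousOn (fun p : ℝ × EuclideanSpace ℝ (Fin N) => F p.1 p.2)
      (Ioo 0 t₁ ×ˢ closure Ω))
    (hF : ∀ t ∈ Ioo 0 t₁, ContDiffOn ℝ 1 (F t) Ω)
    (hFn : ∀ t ∈ Ioo 0 t₁, ∀ y η, IsOutwardUnitNormal Ω y η → inner ℝ (F t y) η = 0)
    (hle : ∀ t ∈ Ioo 0 t₁, ∀ x ∈ Ω, D' t x ≤ divergence (F t) x) :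
    ∫ x in Ω, D t₁ x ≤ ∫ x in Ω, D 0 x := by
  have hb := hΩ.isBounded
  have hcomp : IsCompact (closure Ω) :=
    Metric.isCompact_of_isClosed_isBounded isClosed_closure hb.closure
  have hDt : ∀ t ∈ Ioo 0 t₁, ContinuousOn (D t) (closure Ω) := fun t ht =>
    continuousOn_slice hDc (Ioo_subset_Icc_self ht)
  obtain ⟨C, ε₀, hε₀, hC⟩ := exists_integral_cutoff_mul_divergence_bound hΩ hne
  -- It suffices to compare two interior times.
  have hmono : ∀ a ∈ Ioo 0 t₁, ∀ b ∈ Ioo 0 t₁, a ≤ b →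
      ∫ x in Ω, D b x ≤ ∫ x in Ω, D a x := by
    intro a ha b hb' hab
    have hIcc : Icc a b ⊆ Ioo 0 t₁ := fun t ht => ⟨ha.1.trans_le ht.1, ht.2.trans_lt hb'.2⟩
    have huc := (isCompact_Icc.prod hcomp).uniformContinuousOn_of_continuous
      (hFc.mono (prod_mono_left hIcc))
    rw [Metric.uniformContinuousOn_iff_le] at huc
    have hη : ∀ η : ℝ, 0 < η → (∫ x in Ω, D b x) - ∫ x in Ω, D a x ≤ C * η * (b - a) := by
      intro η hη
      obtain ⟨δ, hδ, hδF⟩ := huc η hη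
      have hev : ∀ᶠ ε : ℝ in 𝓝[>] 0, (∫ x, cutoff Ω ε x * D b x) - ∫ x, cutoff Ω ε x * D a x
          ≤ C * η * (b - a) := by
        have h1 : ∀ᶠ ε : ℝ in 𝓝[>] 0, ε < min ε₀ (δ / 2) :=
          nhdsWithin_le_nhds (Iio_mem_nhds (by positivity))
        filter_upwards [h1, eventually_mem_nhdsWithin] with ε hε hε0
        replace hε0 : 0 < ε := hε0
        have hd : ∀ t ∈ Icc a b, HasDerivAt (fun s => ∫ x, cutoff Ω ε x * D s x)
            (∫ x, cutoff Ω ε x * D' t x) t := fun t ht =>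
          hasDerivAt_integral_cutoff_mul hΩ.isOpen hb
            (fun t ht => (hDt t ht).mono subset_closure) hD hD' hε0 (hIcc ht)
        refine (convex_Icc a b).image_sub_le_mul_sub_of_deriv_le
          (fun t ht => (hd t ht).continuousAt.continuousWithinAt)
          (fun t ht => (hd t (interior_subset ht)).differentiableAt.differentiableWithinAt)
          (fun t ht => ?_) a (left_mem_Icc.2 hab) b (right_mem_Icc.2 hab) hab
        replace ht := interior_subset ht
        rw [(hd t ht).deriv]
        have hsub := tsupport_cutoff_subset (Ω := Ω) hε0
        have hcs := hasCompactSupport_cutoff hb hε0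
        have hle' : ∫ x, cutoff Ω ε x * D' t x ≤ ∫ x, cutoff Ω ε x * divergence (F t) x := by
          refine integral_mono
            ((continuous_mul_of_tsupport_subset hΩ.isOpen (continuous_cutoff ε) hsub
              (continuousOn_slice hD' (hIcc ht))).integrable_of_hasCompactSupport hcs.mul_right)
            ((continuous_mul_of_tsupport_subset hΩ.isOpen (continuous_cutoff ε) hsub
              (continuousOn_divergence hΩ.isOpen (hF t (hIcc ht)))).integrable_of_hasCompactSupport
                hcs.mul_right) fun x => ?_
          by_cases hx : x ∈ Ω
          · exact mul_le_mul_of_nonneg_left (hle t (hIcc ht) x hx) (cutoff_nonneg _ _)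
          · simp [image_eq_zero_of_notMem_tsupport fun h => hx (hsub h)]
        refine hle'.trans ((le_abs_self _).trans (hC ε hε0 (hε.le.trans (min_le_left _ _)) (F t) η
          hη.le (hF t (hIcc ht)) (hFn t (hIcc ht)) fun x hx y hy hxy => ?_))
        rw [← dist_eq_norm]
        refine hδF (t, x) ⟨ht, subset_closure hx⟩ (t, y) ⟨ht, frontier_subset_closure hy⟩ ?_
        rw [Prod.dist_eq, dist_self, max_eq_right dist_nonneg]
        have := hε.trans_le (min_le_right _ _)
        simp only
        linarith
      exact le_of_tendsto ((tendsto_integral_cutoff_mul hΩ.isOpen hb hne (hDt b hb')).sub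
        (tendsto_integral_cutoff_mul hΩ.isOpen hb hne (hDt a ha))) hev
    have hlim : Tendsto (fun η : ℝ => C * η * (b - a)) (𝓝[>] 0) (𝓝 0) := by
      have : Tendsto (fun η : ℝ => C * η * (b - a)) (𝓝 0) (𝓝 (C * 0 * (b - a))) := by
        apply Continuous.tendsto; fun_prop
      simpa using this.mono_left nhdsWithin_le_nhds
    have := ge_of_tendsto hlim (eventually_mem_nhdsWithin.mono fun η h => hη η h)
    linarith
  have hcont := continuousOn_setIntegral hb hΩ.isOpen.measurableSet hDc
  have hmid : t₁ / 2 ∈ Ioo 0 t₁ := ⟨by linarith, by linarith⟩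
  have hleft : ∫ x in Ω, D (t₁ / 2) x ≤ ∫ x in Ω, D 0 x := by
    have : (𝓝[Ioo 0 (t₁ / 2)] (0 : ℝ)).NeBot := left_nhdsWithin_Ioo_neBot hmid.1
    refine ge_of_tendsto ((hcont 0 (left_mem_Icc.2 ht₁.le)).mono
      ((Ioo_subset_Ioo_right hmid.2.le).trans Ioo_subset_Icc_self))
      (eventually_mem_nhdsWithin.mono fun t ht => ?_)
    exact hmono t ⟨ht.1, ht.2.trans hmid.2⟩ _ hmid ht.2.le
  have hright : ∫ x in Ω, D t₁ x ≤ ∫ x in Ω, D (t₁ / 2) x := by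
    have : (𝓝[Ioo (t₁ / 2) t₁] t₁).NeBot := right_nhdsWithin_Ioo_neBot hmid.2
    refine le_of_tendsto ((hcont t₁ (right_mem_Icc.2 ht₁.le)).mono
      ((Ioo_subset_Ioo_left hmid.1.le).trans Ioo_subset_Icc_self))
      (eventually_mem_nhdsWithin.mono fun t ht => ?_)
    exact hmono _ hmid t ⟨hmid.1.trans ht.1, ht.2⟩ ht.1.le
  exact hright.trans hleft

/-! ### Neumann regularity and the minimum principle -/

theorem contDiffOn_gradient (hΩ : IsOpen Ω) {z : EuclideanSpace ℝ (Fin N) → ℝ}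
    (hz : ContDiffOn ℝ 2 z Ω) : ContDiffOn ℝ 1 (gradient z) Ω :=
  (InnerProductSpace.toDual ℝ (EuclideanSpace ℝ (Fin N))).symm.contDiff.comp_contDiffOn
    (hz.fderiv_of_isOpen hΩ (by norm_num))

theorem divergence_congr {V W : EuclideanSpace ℝ (Fin N) → EuclideanSpace ℝ (Fin N)}
    {x : EuclideanSpace ℝ (Fin N)} (h : V =ᶠ[𝓝 x] W) : divergence V x = divergence W x := by
  unfold divergence; rw [h.fderiv_eq]

theorem divergence_add {V W : EuclideanSpace ℝ (Fin N) → EuclideanSpace ℝ (Fin N)}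
    {x : EuclideanSpace ℝ (Fin N)} (hV : DifferentiableAt ℝ V x) (hW : DifferentiableAt ℝ W x) :
    divergence (fun y => V y + W y) x = divergence V x + divergence W x := by
  unfold divergence
  rw [fderiv_fun_add hV hW, ← Finset.sum_add_distrib]
  simp

theorem divergence_smul {φ : EuclideanSpace ℝ (Fin N) → ℝ}
    {V : EuclideanSpace ℝ (Fin N) → EuclideanSpace ℝ (Fin N)} {x : EuclideanSpace ℝ (Fin N)}
    (hφ : DifferentiableAt ℝ φ x) (hV : DifferentiableAt ℝ V x) :
    divergence (fun y => φ y • V y) x = fderiv ℝ φ x (V x) + φ x * divergence V x := by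
  unfold divergence
  rw [fderiv_fun_smul hφ hV]
  have h : fderiv ℝ φ x (V x) = ∑ i, fderiv ℝ φ x (EuclideanSpace.single i 1) * V x i := by
    conv_lhs => rw [← (EuclideanSpace.basisFun (Fin N) ℝ).sum_repr (V x)]
    simp [mul_comm]
  rw [h, Finset.mul_sum, ← Finset.sum_add_distrib]
  refine Finset.sum_congr rfl fun i _ => ?_
  simp
  ring

theorem divergence_gradient (hΩ : IsOpen Ω) {z : EuclideanSpace ℝ (Fin N) → ℝ}
    (hz : ContDiffOn ℝ 2 z Ω) {x : EuclideanSpace ℝ (Fin N)} (hx : x ∈ Ω) :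
    divergence (gradient z) x = Laplacian.laplacian z x := by
  rw [InnerProductSpace.laplacian_eq_iteratedFDeriv_orthonormalBasis z
    (EuclideanSpace.basisFun (Fin N) ℝ)]
  unfold divergence
  refine Finset.sum_congr rfl fun i _ => ?_
  rw [iteratedFDeriv_two_apply]
  have hd : DifferentiableAt ℝ (fderiv ℝ z) x :=
    ((hz.fderiv_of_isOpen hΩ (m := 1) (by norm_num)).contDiffAt (hΩ.mem_nhds hx)).differentiableAt
      one_ne_zero
  have hg : DifferentiableAt ℝ (gradient z) x :=
    ((contDiffOn_gradient hΩ hz).contDiffAt (hΩ.mem_nhds hx)).differentiableAt one_ne_zero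
  have h1 := (EuclideanSpace.proj (𝕜 := ℝ) i : EuclideanSpace ℝ (Fin N) →L[ℝ] ℝ).hasFDerivAt.comp x
    hg.hasFDerivAt
  have h2 := hd.hasFDerivAt.clm_apply
    (hasFDerivAt_const (EuclideanSpace.single i (1 : ℝ) : EuclideanSpace ℝ (Fin N)) x)
  have heq : (⇑(EuclideanSpace.proj (𝕜 := ℝ) i : EuclideanSpace ℝ (Fin N) →L[ℝ] ℝ) ∘ gradient z)
      = fun y => fderiv ℝ z y (EuclideanSpace.single i 1) := by
    ext y
    have h3 : fderiv ℝ z y (EuclideanSpace.single i 1)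
        = inner ℝ (gradient z y) (EuclideanSpace.single i 1) := by
      rw [← toDual_gradient, InnerProductSpace.toDual_apply_apply]
    rw [h3, EuclideanSpace.inner_single_right]
    simp
  rw [heq] at h1
  have := DFunLike.congr_fun (h1.unique h2) (EuclideanSpace.single i 1)
  simpa using this

/-- The properties of one component `z` on `[0, t₁] × closure Ω`, with `G` the continuous extension
of its spatial gradient up to the boundary, that enter the integral estimates. -/
structure IsNeumannRegular (Ω : Set (EuclideanSpace ℝ (Fin N))) (t₁ : ℝ)
    (z : ℝ → EuclideanSpace ℝ (Fin N) → ℝ)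
    (G : ℝ → EuclideanSpace ℝ (Fin N) → EuclideanSpace ℝ (Fin N)) : Prop where
  continuousOn : ContinuousOn (fun p : ℝ × EuclideanSpace ℝ (Fin N) => z p.1 p.2)
    (Icc 0 t₁ ×ˢ closure Ω)
  hasDerivAt : ∀ t ∈ Ioo 0 t₁, ∀ x ∈ Ω,
    HasDerivAt (fun s => z s x) (deriv (fun s => z s x) t) t
  continuousOn_deriv : ContinuousOn
    (fun p : ℝ × EuclideanSpace ℝ (Fin N) => deriv (fun s => z s p.2) p.1) (Ioo 0 t₁ ×ˢ Ω)
  contDiffOn : ∀ t ∈ Ioo 0 t₁, ContDiffOn ℝ 2 (z t) Ω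
  continuousOn_grad : ContinuousOn (fun p : ℝ × EuclideanSpace ℝ (Fin N) => G p.1 p.2)
    (Ioo 0 t₁ ×ˢ closure Ω)
  grad_eq : ∀ t ∈ Ioo 0 t₁, ∀ x ∈ Ω, G t x = gradient (z t) x
  grad_normal : ∀ t ∈ Ioo 0 t₁, ∀ y η, IsOutwardUnitNormal Ω y η → inner ℝ (G t y) η = 0

theorem IsClassicalRegular.exists_isNeumannRegular {T : EReal}
    {z : ℝ → EuclideanSpace ℝ (Fin N) → ℝ} (h : IsClassicalRegular Ω T z)
    (hN : SatisfiesNeumann Ω T z) :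
    ∃ G, ∀ t₁ : ℝ, (t₁ : EReal) < T → IsNeumannRegular Ω t₁ z G := by
  obtain ⟨G, hGc, hG⟩ := hN
  refine ⟨G, fun t₁ ht₁ => ?_⟩
  have hlt : ∀ t ≤ t₁, (t : EReal) < T := fun t ht =>
    (EReal.coe_le_coe_iff.2 ht).trans_lt ht₁
  have h0 : Icc 0 t₁ ⊆ {t : ℝ | 0 ≤ t ∧ (t : EReal) < T} := fun t ht => ⟨ht.1, hlt t ht.2⟩
  have h1 : Ioo 0 t₁ ⊆ {t : ℝ | 0 < t ∧ (t : EReal) < T} := fun t ht => ⟨ht.1, hlt t ht.2.le⟩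
  exact
    { continuousOn := h.continuousOn.mono (prod_mono_left h0)
      hasDerivAt := fun t ht x hx =>
        (h.differentiable_time t (h1 ht).1 (h1 ht).2 x hx).hasDerivAt
      continuousOn_deriv := h.continuousOn_time.mono (prod_mono_left h1)
      contDiffOn := fun t ht => h.contDiffOn_space t (h1 ht).1 (h1 ht).2
      continuousOn_grad := hGc.mono (prod_mono_left h1)
      grad_eq := fun t ht => (hG t (h1 ht).1 (h1 ht).2).1
      grad_normal := fun t ht => (hG t (h1 ht).1 (h1 ht).2).2 }

namespace IsNeumannRegular

variable {t₁ t : ℝ} {z : ℝ → EuclideanSpace ℝ (Fin N) → ℝ}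
  {G : ℝ → EuclideanSpace ℝ (Fin N) → EuclideanSpace ℝ (Fin N)}

theorem eventuallyEq_gradient (h : IsNeumannRegular Ω t₁ z G) (hΩ : IsOpen Ω) (ht : t ∈ Ioo 0 t₁)
    {x : EuclideanSpace ℝ (Fin N)} (hx : x ∈ Ω) : G t =ᶠ[𝓝 x] gradient (z t) := by
  filter_upwards [hΩ.mem_nhds hx] with y hy using h.grad_eq t ht y hy

theorem contDiffOn_grad (h : IsNeumannRegular Ω t₁ z G) (hΩ : IsOpen Ω) (ht : t ∈ Ioo 0 t₁) :
    ContDiffOn ℝ 1 (G t) Ω :=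
  (contDiffOn_gradient hΩ (h.contDiffOn t ht)).congr (h.grad_eq t ht)

theorem differentiableAt_grad (h : IsNeumannRegular Ω t₁ z G) (hΩ : IsOpen Ω) (ht : t ∈ Ioo 0 t₁)
    {x : EuclideanSpace ℝ (Fin N)} (hx : x ∈ Ω) : DifferentiableAt ℝ (G t) x :=
  ((h.contDiffOn_grad hΩ ht).contDiffAt (hΩ.mem_nhds hx)).differentiableAt one_ne_zero

theorem hasFDerivAt (h : IsNeumannRegular Ω t₁ z G) (hΩ : IsOpen Ω) (ht : t ∈ Ioo 0 t₁)
    {x : EuclideanSpace ℝ (Fin N)} (hx : x ∈ Ω) : HasFDerivAt (z t) (innerSL ℝ (G t x)) x := by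
  have hd : DifferentiableAt ℝ (z t) x :=
    ((h.contDiffOn t ht).contDiffAt (hΩ.mem_nhds hx)).differentiableAt two_ne_zero
  rw [h.grad_eq t ht x hx]
  exact hd.hasGradientAt.hasFDerivAt

theorem divergence_smul_grad (h : IsNeumannRegular Ω t₁ z G) (hΩ : IsOpen Ω) (ht : t ∈ Ioo 0 t₁)
    {x : EuclideanSpace ℝ (Fin N)} (hx : x ∈ Ω) {φ : EuclideanSpace ℝ (Fin N) → ℝ}
    {φ' : EuclideanSpace ℝ (Fin N) →L[ℝ] ℝ} (hφ : HasFDerivAt φ φ' x) :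
    divergence (fun y => φ y • G t y) x =
      φ' (G t x) + φ x * Laplacian.laplacian (z t) x := by
  rw [divergence_smul hφ.differentiableAt (h.differentiableAt_grad hΩ ht hx), hφ.fderiv,
    divergence_congr (h.eventuallyEq_gradient hΩ ht hx),
    divergence_gradient hΩ (h.contDiffOn t ht) hx]

end IsNeumannRegular

theorem hasDerivAt_max_zero_pow (n : ℕ) (s : ℝ) :
    HasDerivAt (fun s : ℝ => max s 0 ^ (n + 2)) ((n + 2) * max s 0 ^ (n + 1)) s := by
  rcases lt_trichotomy s 0 with hs | rfl | hs
  · have : (fun s : ℝ => max s 0 ^ (n + 2)) =ᶠ[𝓝 s] fun _ => 0 := by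
      filter_upwards [Iio_mem_nhds hs] with r hr
      rw [max_eq_right (le_of_lt hr)]; simp
    rw [max_eq_right hs.le]
    simpa using (hasDerivAt_const s (0 : ℝ)).congr_of_eventuallyEq this
  · rw [hasDerivAt_iff_tendsto_slope]
    have hc : Tendsto (fun s : ℝ => max s 0 ^ (n + 1)) (𝓝[≠] 0) (𝓝 (max (0 : ℝ) 0 ^ (n + 1))) := by
      have : Continuous fun s : ℝ => max s 0 ^ (n + 1) := by fun_prop
      exact this.continuousAt.tendsto.mono_left nhdsWithin_le_nhds
    simp only [max_self, ne_eq, Nat.add_eq_zero_iff, one_ne_zero, and_false, not_false_eq_true,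
      zero_pow, mul_zero] at hc ⊢
    refine hc.congr' ?_
    filter_upwards [eventually_mem_nhdsWithin] with r hr
    have hr0 : r ≠ 0 := hr
    rw [slope_def_field, max_self, zero_pow (by simp), sub_zero, sub_zero]
    rcases le_total r 0 with h | h
    · rw [max_eq_right h]; simp
    · rw [max_eq_left h]; field_simp; ring
  · have : (fun s : ℝ => max s 0 ^ (n + 2)) =ᶠ[𝓝 s] fun s => s ^ (n + 2) := by
      filter_upwards [Ioi_mem_nhds hs] with r hr
      rw [max_eq_left (le_of_lt hr)]
    rw [max_eq_left hs.le]
    have h2 := (hasDerivAt_pow (n + 2) s).congr_of_eventuallyEq this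
    simpa using h2

theorem contDiff_max_zero_sq : ContDiff ℝ 1 fun s : ℝ => max s 0 ^ 2 := by
  refine contDiff_one_iff_deriv.2 ⟨fun s => (hasDerivAt_max_zero_pow 0 s).differentiableAt, ?_⟩
  have : deriv (fun s : ℝ => max s 0 ^ 2) = fun s => 2 * max s 0 := by
    ext s; simpa using (hasDerivAt_max_zero_pow 0 s).deriv
  rw [this]; fun_prop

/-- The minimum principle for supersolutions of `∂ₜz = aΔz - bz` with Neumann boundary condition.
A `C¹` boundary need not admit Hopf's lemma, so the proof shows instead that the integral of
`(m - e^{bt} z)₊³` does not grow. -/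
theorem IsNeumannRegular.mul_exp_le (hΩ : IsBoundedC1Domain Ω) (hne : Ωᶜ.Nonempty) {t₁ : ℝ}
    (ht₁ : 0 < t₁) {z : ℝ → EuclideanSpace ℝ (Fin N) → ℝ}
    {G : ℝ → EuclideanSpace ℝ (Fin N) → EuclideanSpace ℝ (Fin N)}
    (h : IsNeumannRegular Ω t₁ z G) {a b m : ℝ} (ha : 0 < a) (h0 : ∀ x ∈ Ω, m ≤ z 0 x)
    (hsup : ∀ t ∈ Ioo 0 t₁, ∀ x ∈ Ω,
      0 ≤ deriv (fun s => z s x) t - a * Laplacian.laplacian (z t) x + b * z t x) :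
    ∀ x ∈ closure Ω, m * Real.exp (-b * t₁) ≤ z t₁ x := by
  have hexp : Continuous fun p : ℝ × EuclideanSpace ℝ (Fin N) => Real.exp (b * p.1) := by fun_prop
  set y : ℝ → EuclideanSpace ℝ (Fin N) → ℝ := fun t x => m - Real.exp (b * t) * z t x with hy
  have hyc : ContinuousOn (fun p : ℝ × EuclideanSpace ℝ (Fin N) => y p.1 p.2)
      (Icc 0 t₁ ×ˢ closure Ω) := continuousOn_const.sub (hexp.continuousOn.mul h.continuousOn)
  have hDc : ContinuousOn (fun p : ℝ × EuclideanSpace ℝ (Fin N) => max (y p.1 p.2) 0 ^ 3)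
      (Icc 0 t₁ ×ˢ closure Ω) := (hyc.sup continuousOn_const).pow 3
  have hIoo : Ioo 0 t₁ ×ˢ closure Ω ⊆ Icc 0 t₁ ×ˢ closure Ω := prod_mono_left Ioo_subset_Icc_self
  have hIooΩ : Ioo 0 t₁ ×ˢ Ω ⊆ Icc 0 t₁ ×ˢ closure Ω :=
    prod_mono Ioo_subset_Icc_self subset_closure
  set φ : ℝ → EuclideanSpace ℝ (Fin N) → ℝ := fun t x =>
    -(3 * Real.exp (b * t)) * max (y t x) 0 ^ 2 with hφ
  have hφc : ContinuousOn (fun p : ℝ × EuclideanSpace ℝ (Fin N) => φ p.1 p.2)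
      (Icc 0 t₁ ×ˢ closure Ω) :=
    (continuousOn_const.mul hexp.continuousOn).neg.mul ((hyc.sup continuousOn_const).pow 2)
  have key := setIntegral_le_of_deriv_le_divergence hΩ hne ht₁
    (D := fun t x => max (y t x) 0 ^ 3)
    (D' := fun t x => φ t x * (b * z t x + deriv (fun s => z s x) t))
    (F := fun t x => (a * φ t x) • G t x) hDc ?_ ?_ ?_ ?_ ?_ ?_
  · have hz0 : ∫ x in Ω, max (y 0 x) 0 ^ 3 = 0 := by
      refine setIntegral_eq_zero_of_forall_eq_zero fun x hx => ?_
      have : y 0 x ≤ 0 := by simp only [hy, mul_zero, Real.exp_zero, one_mul]; linarith [h0 x hx]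
      rw [max_eq_right this]; simp
    rw [hz0] at key
    have hct : ContinuousOn (fun x => max (y t₁ x) 0 ^ 3) (closure Ω) :=
      continuousOn_slice (f := fun t x => max (y t x) 0 ^ 3) hDc (right_mem_Icc.2 ht₁.le)
    have hnn : ∀ x, 0 ≤ max (y t₁ x) 0 ^ 3 := fun x => pow_nonneg (le_max_right _ _) 3
    have hzero : ∫ x in Ω, max (y t₁ x) 0 ^ 3 = 0 :=
      le_antisymm key (integral_nonneg hnn)
    rw [integral_eq_zero_iff_of_nonneg hnn
      (integrableOn_of_continuousOn_closure hΩ.isBounded hct)] at hzero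
    have heq := Measure.eqOn_open_of_ae_eq hzero hΩ.isOpen (hct.mono subset_closure)
      continuousOn_const
    have hin : ∀ x ∈ Ω, m * Real.exp (-b * t₁) ≤ z t₁ x := by
      intro x hx
      have h1 : max (y t₁ x) 0 = 0 := by
        have := heq hx
        simpa using this
      have h2 : y t₁ x ≤ 0 := by rw [← h1]; exact le_max_left _ _
      have h3 : m ≤ Real.exp (b * t₁) * z t₁ x := by simp only [hy] at h2; linarith
      calc m * Real.exp (-b * t₁) ≤ (Real.exp (b * t₁) * z t₁ x) * Real.exp (-b * t₁) := by gcongr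
        _ = (Real.exp (b * t₁) * Real.exp (-b * t₁)) * z t₁ x := by ring
        _ = z t₁ x := by rw [← Real.exp_add]; simp
    intro x hx
    exact le_on_closure hin continuousOn_const
      (continuousOn_slice h.continuousOn (right_mem_Icc.2 ht₁.le)) hx
  · intro t ht x hx
    have h1 : HasDerivAt (fun s => y s x)
        (-(Real.exp (b * t) * b * z t x + Real.exp (b * t) * deriv (fun s => z s x) t)) t := by
      have e1 : HasDerivAt (fun s => Real.exp (b * s)) (Real.exp (b * t) * b) t := by
        simpa using ((hasDerivAt_id t).const_mul b).exp
      exact (e1.mul (h.hasDerivAt t ht x hx)).const_sub m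
    have h2 : HasDerivAt (fun s => max (y s x) 0 ^ 3) _ t :=
      HasDerivAt.comp (h₂ := fun r : ℝ => max r 0 ^ 3) t (hasDerivAt_max_zero_pow 1 (y t x)) h1
    refine h2.congr_deriv ?_
    simp only [hφ]; push_cast; ring
  · exact (hφc.mono hIooΩ).mul ((continuousOn_const.mul (h.continuousOn.mono hIooΩ)).add
      h.continuousOn_deriv)
  · exact (continuousOn_const.mul (hφc.mono hIoo)).smul h.continuousOn_grad
  · intro t ht
    have hφt : ContDiffOn ℝ 1 (fun x => a * φ t x) Ω :=
      contDiffOn_const.mul (contDiffOn_const.mul (contDiff_max_zero_sq.comp_contDiffOn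
      (contDiffOn_const.sub (contDiffOn_const.mul ((h.contDiffOn t ht).of_le (by norm_num))))))
    exact hφt.smul (h.contDiffOn_grad hΩ.isOpen ht)
  · intro t ht x η hη
    rw [inner_smul_left, h.grad_normal t ht x η hη, mul_zero]
  · intro t ht x hx
    have hφ' : HasFDerivAt (fun x => a * φ t x)
        ((6 * a * Real.exp (b * t) ^ 2 * max (y t x) 0) • innerSL ℝ (G t x)) x := by
      have h1 : HasFDerivAt (y t) (-(Real.exp (b * t) • innerSL ℝ (G t x))) x :=
        ((h.hasFDerivAt hΩ.isOpen ht hx).const_mul _).const_sub m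
      have h2 : HasFDerivAt (fun x => a * φ t x) _ x :=
        (((hasDerivAt_max_zero_pow 0 (y t x)).comp_hasFDerivAt x h1).const_mul
          (-(3 * Real.exp (b * t)))).const_mul a
      refine h2.congr_fderiv ?_
      ext v
      simp only [_root_.smul_apply, _root_.neg_apply, smul_eq_mul]
      push_cast; ring
    rw [h.divergence_smul_grad hΩ.isOpen ht hx hφ']
    simp only [_root_.smul_apply, innerSL_apply_apply, smul_eq_mul, real_inner_self_eq_norm_sq]
    have hm : 0 ≤ max (y t x) 0 := le_max_right _ _
    have hφ0 : φ t x ≤ 0 := by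
      simp only [hφ, neg_mul]; rw [neg_nonpos]; positivity
    have h1 : 0 ≤ 6 * a * Real.exp (b * t) ^ 2 * max (y t x) 0 * ‖G t x‖ ^ 2 := by positivity
    have h2 := mul_nonneg (neg_nonneg.2 hφ0) (hsup t ht x hx)
    nlinarith

/-! ### Quadratic form and reaction terms -/

theorem ternary_quadratic_nonneg {s p r A₁₂ A₁₃ A₂₃ : ℝ} (hs : 0 < s) (hp : 0 ≤ s * p - A₁₂ ^ 2)
    (hr : 0 ≤ s * r - A₁₃ ^ 2)
    (hdet : (s * A₂₃ - A₁₂ * A₁₃) ^ 2 ≤ (s * p - A₁₂ ^ 2) * (s * r - A₁₃ ^ 2)) (x y z : ℝ) :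
    0 ≤ s * x ^ 2 + p * y ^ 2 + r * z ^ 2 - 2 * A₁₂ * x * y - 2 * A₁₃ * x * z
      + 2 * A₂₃ * y * z := by
  set B := s * p - A₁₂ ^ 2
  set C := s * r - A₁₃ ^ 2
  set H := s * A₂₃ - A₁₂ * A₁₃
  have h1 : 0 ≤ B * y ^ 2 + C * z ^ 2 + 2 * H * y * z := by
    have h2 : |H| ≤ √B * √C := by
      rw [← Real.sqrt_mul hp]; exact Real.abs_le_sqrt hdet
    have h3 : -(√B * √C * |y| * |z|) ≤ H * y * z := by
      have : |H * y * z| ≤ √B * √C * |y| * |z| := by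
        rw [abs_mul, abs_mul]; gcongr
      exact (abs_le.1 this).1
    have h4 := sq_nonneg (√B * |y| - √C * |z|)
    have h5 : (√B * |y| - √C * |z|) ^ 2
        = B * y ^ 2 + C * z ^ 2 - 2 * (√B * √C * |y| * |z|) := by
      rw [sub_sq, mul_pow, mul_pow, Real.sq_sqrt hp, Real.sq_sqrt hr, sq_abs, sq_abs]; ring
    linarith
  have h6 : s * (s * x ^ 2 + p * y ^ 2 + r * z ^ 2 - 2 * A₁₂ * x * y - 2 * A₁₃ * x * z
      + 2 * A₂₃ * y * z) = (s * x - A₁₂ * y - A₁₃ * z) ^ 2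
        + (B * y ^ 2 + C * z ^ 2 + 2 * H * y * z) := by
    simp only [B, C, H]; ring
  have h7 : 0 ≤ s * (s * x ^ 2 + p * y ^ 2 + r * z ^ 2 - 2 * A₁₂ * x * y - 2 * A₁₃ * x * z
      + 2 * A₂₃ * y * z) := by rw [h6]; positivity
  exact nonneg_of_mul_nonneg_right h7 hs

theorem add_eq_two_mul_A {a a' : ℝ} (ha : 0 < a) (ha' : 0 < a') :
    a + a' = 2 * A a a' * (√a * √a') := by
  have h1 : 0 < √a := Real.sqrt_pos.2 ha
  have h2 : 0 < √a' := Real.sqrt_pos.2 ha'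
  rw [A, Real.sqrt_mul ha.le]
  field_simp

theorem WeightCondition.two_lt_α {P : Params} {α β γ : ℝ} (h : WeightCondition P α β γ) :
    2 < α := by
  have := h.α_gt
  have := le_max_left 1 ((P.b₂ + P.b₃) / P.b₁)
  linarith

/-- The weight condition makes the quadratic form in the logarithmic gradients, which the diffusion
terms produce, positive semidefinite. -/
theorem WeightCondition.diffusion_form_nonneg {P : Params} {α β γ : ℝ}
    (h : WeightCondition P α β γ) (hP : P.Admissible) (X Y Z : ℝ) :
    0 ≤ P.a₁ * α * (α - 1) * X ^ 2 + P.a₂ * β * (β + 1) * Y ^ 2 + P.a₃ * γ * (γ + 1) * Z ^ 2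
      - (P.a₁ + P.a₂) * α * β * (X * Y) - (P.a₁ + P.a₃) * α * γ * (X * Z)
      + (P.a₂ + P.a₃) * β * γ * (Y * Z) := by
  obtain ⟨ha₁, ha₂, ha₃⟩ := hP.a_pos
  have hα := h.two_lt_α
  have hβ := h.β_pos
  have hγ := h.γ_pos
  have h1 : 0 < 1 / (2 * β) - A P.a₁ P.a₂ ^ 2 := by
    have := h.β_inv_gt
    have e : 1 / (2 * β) = 1 / β / 2 := by field_simp
    rw [e]; linarith
  have h2 : 0 < 1 / (2 * γ) - A P.a₁ P.a₃ ^ 2 := by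
    have := h.det_gt
    exact pos_of_mul_pos_right ((sq_nonneg _).trans_lt this) h1.le
  set s := (α - 1) / α with hs
  have hs2 : 1 / 2 < s := by
    rw [hs, lt_div_iff₀ (by linarith)]; linarith
  have hp : 1 / (2 * β) ≤ s * (1 + 1 / β) := by
    have e : 1 / (2 * β) = 1 / 2 * (1 / β) := by field_simp
    rw [e]
    have : 0 < 1 / β := by positivity
    nlinarith
  have hr : 1 / (2 * γ) ≤ s * (1 + 1 / γ) := by
    have e : 1 / (2 * γ) = 1 / 2 * (1 / γ) := by field_simp
    rw [e]
    have : 0 < 1 / γ := by positivity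
    nlinarith
  have hdet : (s * A P.a₂ P.a₃ - A P.a₁ P.a₂ * A P.a₁ P.a₃) ^ 2 ≤
      (s * (1 + 1 / β) - A P.a₁ P.a₂ ^ 2) * (s * (1 + 1 / γ) - A P.a₁ P.a₃ ^ 2) := by
    refine h.det_gt.le.trans ?_
    exact mul_le_mul (by linarith) (by linarith) h2.le (by linarith)
  have key := ternary_quadratic_nonneg (by linarith) (by linarith) (by linarith) hdet
    (α * √P.a₁ * X) (β * √P.a₂ * Y) (γ * √P.a₃ * Z)
  rw [add_eq_two_mul_A ha₁ ha₂, add_eq_two_mul_A ha₁ ha₃, add_eq_two_mul_A ha₂ ha₃]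
  have e1 : s * (α * √P.a₁ * X) ^ 2 = P.a₁ * α * (α - 1) * X ^ 2 := by
    rw [mul_pow, mul_pow, Real.sq_sqrt ha₁.le, hs]
    field_simp
  have e2 : (1 + 1 / β) * (β * √P.a₂ * Y) ^ 2 = P.a₂ * β * (β + 1) * Y ^ 2 := by
    rw [mul_pow, mul_pow, Real.sq_sqrt ha₂.le]; field_simp
  have e3 : (1 + 1 / γ) * (γ * √P.a₃ * Z) ^ 2 = P.a₃ * γ * (γ + 1) * Z ^ 2 := by
    rw [mul_pow, mul_pow, Real.sq_sqrt ha₃.le]; field_simp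
  rw [e1, e2, e3] at key
  linarith

theorem WeightCondition.diffusion_form_inner_nonneg {P : Params} {α β γ : ℝ}
    (h : WeightCondition P α β γ) (hP : P.Admissible) (U V W : EuclideanSpace ℝ (Fin N)) :
    0 ≤ P.a₁ * α * (α - 1) * inner ℝ U U + P.a₂ * β * (β + 1) * inner ℝ V V
      + P.a₃ * γ * (γ + 1) * inner ℝ W W
      - (P.a₁ + P.a₂) * α * β * inner ℝ U V - (P.a₁ + P.a₃) * α * γ * inner ℝ U W
      + (P.a₂ + P.a₃) * β * γ * inner ℝ V W := by
  have := Finset.sum_nonneg fun i (_ : i ∈ (Finset.univ : Finset (Fin N))) =>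
    h.diffusion_form_nonneg hP (U i) (V i) (W i)
  simp only [Finset.sum_add_distrib, Finset.sum_sub_distrib, ← Finset.mul_sum] at this
  have e : ∀ A B : EuclideanSpace ℝ (Fin N), inner ℝ A B = ∑ i, A i * B i := fun A B => by
    simp [PiLp.inner_apply, mul_comm]
  simp only [e]
  simpa only [sq] using this

/-- A power with exponent below `1` is dominated by any linear function, up to a constant. -/
theorem exists_mul_rpow_le_linear {θ C κ : ℝ} (hθ0 : 0 < θ) (hθ1 : θ < 1) (hC : 0 ≤ C)
    (hκ : 0 < κ) : ∃ B, 0 ≤ B ∧ ∀ y, 0 ≤ y → C * y ^ θ ≤ κ * y + B := by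
  have hlim : Tendsto (fun y : ℝ => y ^ (-(1 - θ))) atTop (𝓝 0) :=
    tendsto_rpow_neg_atTop (by linarith)
  obtain ⟨R, hR⟩ := eventually_atTop.1 ((hlim.const_mul C).eventually
    (gt_mem_nhds (show C * 0 < κ by simpa using hκ)))
  set S := max R 1
  refine ⟨C * S ^ θ, by positivity, fun y hy => ?_⟩
  rcases le_total y S with h | h
  · have : y ^ θ ≤ S ^ θ := Real.rpow_le_rpow hy h hθ0.le
    have := mul_le_mul_of_nonneg_left this hC
    nlinarith
  · have hy0 : 0 < y := lt_of_lt_of_le (lt_of_lt_of_le one_pos (le_max_right _ _)) h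
    have h1 := (hR y ((le_max_left _ _).trans h)).le
    have h2 : y ^ θ = y ^ (-(1 - θ)) * y := by
      rw [← Real.rpow_add_one hy0.ne']; congr 1; ring
    have h3 : 0 ≤ C * S ^ θ := by positivity
    rw [h2, ← mul_assoc]
    nlinarith

/-- If the exponents of `Y = u ^ p / (v ^ s * w ^ t)` dominate those of the production term after
raising `Y` to the power `θ = e / p < 1`, then, for `v` and `w` bounded below, `Y` absorbs
the production term up to a constant. -/
theorem exists_production_le {e q r c p s t m A κ : ℝ} (he : 0 < e) (hc : 0 ≤ c) (hp : 0 < p)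
    (hep : e / p < 1) (hs : e / p * s ≤ q) (ht : e / p * t ≤ r) (hm : 0 < m) (hA : 0 ≤ A)
    (hκ : 0 < κ) :
    ∃ B, 0 ≤ B ∧ ∀ u v w : ℝ, 0 < u → m ≤ v → m ≤ w →
      A * (u ^ e / (v ^ q * (w ^ r + c))) ≤ κ * (u ^ p / (v ^ s * w ^ t)) + B := by
  set θ := e / p with hθ
  obtain ⟨B, hB, hBy⟩ := exists_mul_rpow_le_linear (θ := θ)
    (C := A * (m ^ (-(q - θ * s)) * m ^ (-(r - θ * t)))) (by positivity) hep (by positivity) hκ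
  refine ⟨B, hB, fun u v w hu hv hw => ?_⟩
  have hv0 : 0 < v := hm.trans_le hv
  have hw0 : 0 < w := hm.trans_le hw
  refine le_trans ?_ (hBy (u ^ p / (v ^ s * w ^ t)) (by positivity))
  rw [mul_assoc]
  gcongr
  have h1 : u ^ e / (v ^ q * (w ^ r + c)) ≤ u ^ e / (v ^ q * w ^ r) := by
    gcongr; linarith
  refine h1.trans ?_
  have h2 : u ^ e / (v ^ q * w ^ r) =
      (v ^ (-(q - θ * s)) * w ^ (-(r - θ * t))) * (u ^ p / (v ^ s * w ^ t)) ^ θ := by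
    rw [Real.div_rpow (by positivity) (by positivity), Real.mul_rpow (by positivity)
      (by positivity), ← Real.rpow_mul hu.le, ← Real.rpow_mul hv0.le, ← Real.rpow_mul hw0.le]
    have e1 : p * θ = e := by rw [hθ]; field_simp
    have e2 : v ^ (-(q - θ * s)) = v ^ (s * θ) / v ^ q := by
      rw [← Real.rpow_sub hv0]; congr 1; ring
    have e3 : w ^ (-(r - θ * t)) = w ^ (t * θ) / w ^ r := by
      rw [← Real.rpow_sub hw0]; congr 1; ring
    have := Real.rpow_pos_of_pos hv0 (s * θ)
    have := Real.rpow_pos_of_pos hw0 (t * θ)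
    rw [e1, e2, e3]
    field_simp
  rw [h2]
  have h3 : v ^ (-(q - θ * s)) ≤ m ^ (-(q - θ * s)) :=
    Real.rpow_le_rpow_of_nonpos hm hv (by linarith)
  have h4 : w ^ (-(r - θ * t)) ≤ m ^ (-(r - θ * t)) :=
    Real.rpow_le_rpow_of_nonpos hm hw (by linarith)
  gcongr

theorem Params.mul_le_of_lt_minRatio {θ x m n : ℝ} (h : θ < minRatio x m n) (hm : 0 ≤ m)
    (hn : 0 ≤ n) : θ < x ∧ θ < 1 ∧ θ * n ≤ m := by
  unfold minRatio at h
  split_ifs at h with h0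
  · rw [lt_min_iff] at h
    exact ⟨h.1, h.2, by rw [h0]; simpa using hm⟩
  · rw [lt_min_iff, lt_min_iff] at h
    have hn' : 0 < n := lt_of_le_of_ne hn (Ne.symm h0)
    exact ⟨h.1, h.2.2, ((lt_div_iff₀ hn').1 h.2.1).le⟩

theorem Params.pos_and_div_lt_of_lt_mul {e p k : ℝ} (he : 0 < e) (hp : 0 ≤ p) (h : e < p * k) :
    0 < p ∧ e / p < k := by
  have hp' : 0 < p := by
    rcases hp.eq_or_lt with rfl | h'
    · simp at h; linarith
    · exact h'
  exact ⟨hp', by rw [div_lt_iff₀ hp']; linarith⟩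

/-- The exponent condition lets the consumption through `v` or through `w` absorb the production
of `u`. -/
theorem Params.ExponentCondition.exists_production_le {P : Params} (hP : P.Admissible)
    (h : P.ExponentCondition) {α β γ m : ℝ} (hα : 0 < α) (hβ : 0 < β) (hγ : 0 < γ) (hm : 0 < m) :
    ∃ B, 0 ≤ B ∧ ∀ u v w : ℝ, 0 < u → m ≤ v → m ≤ w →
      α * (u ^ (P.p₁ - 1) / (v ^ P.q₁ * (w ^ P.r₁ + P.c))) ≤
        β * (u ^ P.p₂ / (v ^ (P.q₂ + 1) * w ^ P.r₂))
          + γ * (u ^ P.p₃ / (v ^ P.q₃ * w ^ (P.r₃ + 1))) + B := by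
  obtain ⟨he, hlt⟩ := h
  obtain ⟨-, hp₂, hp₃⟩ := hP.p_nonneg
  obtain ⟨hq₁, hq₂, hq₃⟩ := hP.q_nonneg
  obtain ⟨hr₁, hr₂, hr₃⟩ := hP.r_nonneg
  rcases lt_max_iff.1 hlt with h | h
  · obtain ⟨hp, hk⟩ := pos_and_div_lt_of_lt_mul he hp₂ h
    obtain ⟨h1, h2, h3⟩ := mul_le_of_lt_minRatio hk hr₁ hr₂
    obtain ⟨B, hB, hBu⟩ := GiererMeinhardt.exists_production_le he hP.c_nonneg hp h2
      ((lt_div_iff₀ (by linarith)).1 h1).le h3 hm hα.le hβ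
    refine ⟨B, hB, fun u v w hu hv hw => ?_⟩
    have hv0 := hm.trans_le hv
    have hw0 := hm.trans_le hw
    have h4 : 0 ≤ γ * (u ^ P.p₃ / (v ^ P.q₃ * w ^ (P.r₃ + 1))) := by positivity
    linarith [hBu u v w hu hv hw]
  · obtain ⟨hp, hk⟩ := pos_and_div_lt_of_lt_mul he hp₃ h
    obtain ⟨h1, h2, h3⟩ := mul_le_of_lt_minRatio hk hq₁ hq₃
    obtain ⟨B, hB, hBu⟩ := GiererMeinhardt.exists_production_le he hP.c_nonneg hp h2 h3
      ((lt_div_iff₀ (by linarith)).1 h1).le hm hα.le hγ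
    refine ⟨B, hB, fun u v w hu hv hw => ?_⟩
    have hv0 := hm.trans_le hv
    have hw0 := hm.trans_le hw
    have h4 : 0 ≤ β * (u ^ P.p₂ / (v ^ (P.q₂ + 1) * w ^ P.r₂)) := by positivity
    linarith [hBu u v w hu hv hw]

/-- The contribution of the reaction terms to the time derivative of `u ^ α / (v ^ β * w ^ γ)`
grows at most linearly in this density, as long as `v` and `w` are bounded below. -/
theorem exists_reaction_le {P : Params} (hP : P.Admissible) (h : P.ExponentCondition)
    {α β γ m : ℝ} (hα : 1 ≤ α) (hβ : 0 < β) (hγ : 0 < γ) (hm : 0 < m) :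
    ∃ K, 0 ≤ K ∧ ∀ u v w : ℝ, 0 < u → m ≤ v → m ≤ w →
      u ^ α * v ^ (-β) * w ^ (-γ) *
        (α * (P.f u v w / u) - β * (P.g u v w / v) - γ * (P.h u v w / w)) ≤
      K * (u ^ α * v ^ (-β) * w ^ (-γ)) + K := by
  obtain ⟨B, hB, hBu⟩ := h.exists_production_le hP (by linarith : 0 < α) hβ hγ hm
  obtain ⟨hb₁, hb₂, hb₃⟩ := hP.b_pos
  have hσ := hP.σ_pos
  set C := α * P.σ * (m ^ (-β) * m ^ (-γ)) with hC
  have hC0 : 0 ≤ C := by positivity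
  refine ⟨C + α * P.σ + β * P.b₂ + γ * P.b₃ + B, by positivity, fun u v w hu hv hw => ?_⟩
  have hv0 := hm.trans_le hv
  have hw0 := hm.trans_le hw
  set D := u ^ α * v ^ (-β) * w ^ (-γ) with hD
  have hD0 : 0 ≤ D := by positivity
  have hf : P.f u v w / u = P.σ / u - P.b₁ + u ^ (P.p₁ - 1) / (v ^ P.q₁ * (w ^ P.r₁ + P.c)) := by
    have : 0 < w ^ P.r₁ + P.c := by have := hP.c_nonneg; positivity
    rw [Params.f, Real.rpow_sub_one hu.ne']; field_simp
  have hg : P.g u v w / v = -P.b₂ + u ^ P.p₂ / (v ^ (P.q₂ + 1) * w ^ P.r₂) := by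
    rw [Params.g, Real.rpow_add_one hv0.ne']; field_simp
  have hh : P.h u v w / w = -P.b₃ + u ^ P.p₃ / (v ^ P.q₃ * w ^ (P.r₃ + 1)) := by
    rw [Params.h, Real.rpow_add_one hw0.ne']; field_simp
  have hprod := hBu u v w hu hv hw
  have hsrc : D * (α * (P.σ / u)) ≤ α * P.σ * D + C := by
    have h1 : D * (α * (P.σ / u)) = α * P.σ * (u ^ (α - 1) * (v ^ (-β) * w ^ (-γ))) := by
      rw [hD, Real.rpow_sub_one hu.ne']; field_simp
    have h2 : u ^ (α - 1) ≤ u ^ α + 1 := by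
      rcases le_total u 1 with h | h
      · have := Real.rpow_le_one hu.le h (by linarith : 0 ≤ α - 1)
        have : 0 < u ^ α := by positivity
        linarith
      · have := Real.rpow_le_rpow_of_exponent_le h (by linarith : α - 1 ≤ α)
        linarith
    have h3 : v ^ (-β) * w ^ (-γ) ≤ m ^ (-β) * m ^ (-γ) :=
      mul_le_mul (Real.rpow_le_rpow_of_nonpos hm hv (by linarith))
        (Real.rpow_le_rpow_of_nonpos hm hw (by linarith)) (by positivity) (by positivity)
    have h4 : u ^ (α - 1) * (v ^ (-β) * w ^ (-γ)) ≤ D + m ^ (-β) * m ^ (-γ) := by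
      have : u ^ (α - 1) * (v ^ (-β) * w ^ (-γ)) ≤ (u ^ α + 1) * (v ^ (-β) * w ^ (-γ)) := by
        gcongr
      have e : (u ^ α + 1) * (v ^ (-β) * w ^ (-γ)) = D + v ^ (-β) * w ^ (-γ) := by rw [hD]; ring
      linarith
    rw [h1, hC]
    have := mul_le_mul_of_nonneg_left h4 (by positivity : 0 ≤ α * P.σ)
    linarith
  rw [hf, hg, hh]
  have hrest := mul_le_mul_of_nonneg_left hprod hD0
  have hpos : 0 ≤ D * (α * P.b₁) := by positivity
  have hx : 0 ≤ α * P.σ + β * P.b₂ + γ * P.b₃ + B := by positivity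
  have hy : 0 ≤ C * D := by positivity
  nlinarith

/-! ### The density and its integral -/

theorem hasFDerivAt_rpow_mul_rpow_mul_rpow {E : Type*} [NormedAddCommGroup E] [NormedSpace ℝ E]
    {u v w : E → ℝ} {u' v' w' : E →L[ℝ] ℝ} {x : E} (hu : HasFDerivAt u u' x)
    (hv : HasFDerivAt v v' x) (hw : HasFDerivAt w w' x) (hu0 : 0 < u x) (hv0 : 0 < v x)
    (hw0 : 0 < w x) (a b c : ℝ) :
    HasFDerivAt (fun y => u y ^ a * v y ^ b * w y ^ c)
      ((u x ^ a * v x ^ b * w x ^ c) • ((a / u x) • u' + (b / v x) • v' + (c / w x) • w')) x := by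
  have h := ((hu.rpow_const (p := a) (Or.inl hu0.ne')).mul
    (hv.rpow_const (p := b) (Or.inl hv0.ne'))).mul (hw.rpow_const (p := c) (Or.inl hw0.ne'))
  refine h.congr_fderiv ?_
  ext y
  simp only [Pi.mul_apply, _root_.add_apply, _root_.smul_apply, smul_eq_mul,
    Real.rpow_sub_one hu0.ne',
    Real.rpow_sub_one hv0.ne', Real.rpow_sub_one hw0.ne']
  field_simp
  ring

theorem contDiffOn_rpow_mul_rpow_mul_rpow {E : Type*} [NormedAddCommGroup E] [NormedSpace ℝ E]
    {n : WithTop ℕ∞} {s : Set E} {u v w : E → ℝ} (hu : ContDiffOn ℝ n u s)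
    (hv : ContDiffOn ℝ n v s) (hw : ContDiffOn ℝ n w s)
    (hpos : ∀ x ∈ s, 0 < u x ∧ 0 < v x ∧ 0 < w x) (a b c : ℝ) :
    ContDiffOn ℝ n (fun y => u y ^ a * v y ^ b * w y ^ c) s :=
  ((hu.rpow_const_of_ne fun x hx => (hpos x hx).1.ne').mul
    (hv.rpow_const_of_ne fun x hx => (hpos x hx).2.1.ne')).mul
    (hw.rpow_const_of_ne fun x hx => (hpos x hx).2.2.ne')

theorem continuousOn_rpow_mul_rpow_mul_rpow {X : Type*} [TopologicalSpace X]
    {s : Set X} {u v w : X → ℝ} (hu : ContinuousOn u s)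
    (hv : ContinuousOn v s) (hw : ContinuousOn w s)
    (hpos : ∀ x ∈ s, 0 < v x ∧ 0 < w x) {a : ℝ} (ha : 0 ≤ a) (b c : ℝ) :
    ContinuousOn (fun y => u y ^ a * v y ^ b * w y ^ c) s :=
  ((hu.rpow_const fun _ _ => Or.inr ha).mul
    (hv.rpow_const fun x hx => Or.inl (hpos x hx).1.ne')).mul
    (hw.rpow_const fun x hx => Or.inl (hpos x hx).2.ne')

theorem density_eq (α β γ : ℝ) {u v w : ℝ → EuclideanSpace ℝ (Fin N) → ℝ} {t : ℝ}
    {x : EuclideanSpace ℝ (Fin N)} (hv : 0 ≤ v t x) (hw : 0 ≤ w t x) :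
    density α β γ u v w t x = u t x ^ α * v t x ^ (-β) * w t x ^ (-γ) := by
  rw [density, Real.rpow_neg hv, Real.rpow_neg hw]
  rw [div_eq_mul_inv, mul_inv, mul_assoc]

/-- The divergence of the flux `a₁∂ᵤD ∇u + a₂∂ᵥD ∇v + a₃∂_wD ∇w` of `D = uᵅv⁻ᵝw⁻ᵞ` is at least the
diffusive part of `∂ₜD`: the difference is the quadratic form of the logarithmic gradients. -/
theorem diffusion_le_divergence (hΩ : IsOpen Ω) {P : Params} (hP : P.Admissible) {α β γ : ℝ}
    (hαβγ : WeightCondition P α β γ) {t₁ t : ℝ} {u v w : ℝ → EuclideanSpace ℝ (Fin N) → ℝ}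
    {G₁ G₂ G₃ : ℝ → EuclideanSpace ℝ (Fin N) → EuclideanSpace ℝ (Fin N)}
    (hu : IsNeumannRegular Ω t₁ u G₁) (hv : IsNeumannRegular Ω t₁ v G₂)
    (hw : IsNeumannRegular Ω t₁ w G₃) (ht : t ∈ Ioo 0 t₁) {x : EuclideanSpace ℝ (Fin N)}
    (hx : x ∈ Ω) (hu0 : 0 < u t x) (hv0 : 0 < v t x) (hw0 : 0 < w t x) {k : ℝ} (hk : 0 ≤ k) :
    k * (u t x ^ α * v t x ^ (-β) * w t x ^ (-γ)) *
      (α * (P.a₁ * Laplacian.laplacian (u t) x / u t x)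
        - β * (P.a₂ * Laplacian.laplacian (v t) x / v t x)
        - γ * (P.a₃ * Laplacian.laplacian (w t) x / w t x)) ≤
    divergence (fun y =>
      (k * α * P.a₁ * (u t y ^ (α - 1) * v t y ^ (-β) * w t y ^ (-γ))) • G₁ t y
      + (-(k * β * P.a₂) * (u t y ^ α * v t y ^ (-β - 1) * w t y ^ (-γ))) • G₂ t y
      + (-(k * γ * P.a₃) * (u t y ^ α * v t y ^ (-β) * w t y ^ (-γ - 1))) • G₃ t y) x := by
  have du := hu.hasFDerivAt hΩ ht hx
  have dv := hv.hasFDerivAt hΩ ht hx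
  have dw := hw.hasFDerivAt hΩ ht hx
  have m1 := (hasFDerivAt_rpow_mul_rpow_mul_rpow du dv dw hu0 hv0 hw0
    (α - 1) (-β) (-γ)).const_mul (k * α * P.a₁)
  have m2 := (hasFDerivAt_rpow_mul_rpow_mul_rpow du dv dw hu0 hv0 hw0
    α (-β - 1) (-γ)).const_mul (-(k * β * P.a₂))
  have m3 := (hasFDerivAt_rpow_mul_rpow_mul_rpow du dv dw hu0 hv0 hw0
    α (-β) (-γ - 1)).const_mul (-(k * γ * P.a₃))
  have g1 := hu.differentiableAt_grad hΩ ht hx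
  have g2 := hv.differentiableAt_grad hΩ ht hx
  have g3 := hw.differentiableAt_grad hΩ ht hx
  have d1 := m1.differentiableAt.fun_smul g1
  have d2 := m2.differentiableAt.fun_smul g2
  have d3 := m3.differentiableAt.fun_smul g3
  rw [divergence_add (d1.fun_add d2) d3, divergence_add d1 d2, hu.divergence_smul_grad hΩ ht hx m1,
    hv.divergence_smul_grad hΩ ht hx m2, hw.divergence_smul_grad hΩ ht hx m3]
  simp only [_root_.add_apply, _root_.smul_apply, smul_eq_mul, innerSL_apply_apply,
    Real.rpow_sub_one hu0.ne', Real.rpow_sub_one hv0.ne', Real.rpow_sub_one hw0.ne']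
  have hQ := hαβγ.diffusion_form_inner_nonneg hP ((u t x)⁻¹ • G₁ t x) ((v t x)⁻¹ • G₂ t x)
    ((w t x)⁻¹ • G₃ t x)
  simp only [inner_smul_left, inner_smul_right, conj_trivial] at hQ
  rw [real_inner_comm (G₁ t x) (G₂ t x), real_inner_comm (G₁ t x) (G₃ t x),
    real_inner_comm (G₂ t x) (G₃ t x)]
  have hD : 0 ≤ k * (u t x ^ α * v t x ^ (-β) * w t x ^ (-γ)) := by positivity
  have key := mul_nonneg hD hQ
  rw [← sub_nonneg]
  refine key.trans_eq ?_
  field_simp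
  ring

/-- The Gronwall estimate for `∫ uᵅv⁻ᵝw⁻ᵞ`, obtained by applying the integral comparison to
`e^{-Kt} uᵅv⁻ᵝw⁻ᵞ - Kt`. -/
theorem setIntegral_weighted_le (hΩ : IsBoundedC1Domain Ω) (hne : Ωᶜ.Nonempty) {P : Params}
    (hP : P.Admissible) {α β γ : ℝ} (hαβγ : WeightCondition P α β γ) {t₁ m K : ℝ} (ht₁ : 0 < t₁)
    (hm : 0 < m) (hK0 : 0 ≤ K)
    (hK : ∀ u v w : ℝ, 0 < u → m ≤ v → m ≤ w →
      u ^ α * v ^ (-β) * w ^ (-γ) *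
        (α * (P.f u v w / u) - β * (P.g u v w / v) - γ * (P.h u v w / w)) ≤
      K * (u ^ α * v ^ (-β) * w ^ (-γ)) + K)
    {u v w : ℝ → EuclideanSpace ℝ (Fin N) → ℝ}
    {G₁ G₂ G₃ : ℝ → EuclideanSpace ℝ (Fin N) → EuclideanSpace ℝ (Fin N)}
    (hu : IsNeumannRegular Ω t₁ u G₁) (hv : IsNeumannRegular Ω t₁ v G₂)
    (hw : IsNeumannRegular Ω t₁ w G₃)
    (hu0 : ∀ t ∈ Icc 0 t₁, ∀ x ∈ Ω, 0 < u t x)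
    (hvm : ∀ t ∈ Icc 0 t₁, ∀ x ∈ closure Ω, m ≤ v t x)
    (hwm : ∀ t ∈ Icc 0 t₁, ∀ x ∈ closure Ω, m ≤ w t x)
    (equ : ∀ t ∈ Ioo 0 t₁, ∀ x ∈ Ω, deriv (fun s => u s x) t
      - P.a₁ * Laplacian.laplacian (u t) x = P.f (u t x) (v t x) (w t x))
    (eqv : ∀ t ∈ Ioo 0 t₁, ∀ x ∈ Ω, deriv (fun s => v s x) t
      - P.a₂ * Laplacian.laplacian (v t) x = P.g (u t x) (v t x) (w t x))
    (eqw : ∀ t ∈ Ioo 0 t₁, ∀ x ∈ Ω, deriv (fun s => w s x) t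
      - P.a₃ * Laplacian.laplacian (w t) x = P.h (u t x) (v t x) (w t x)) :
    ∫ x in Ω, u t₁ x ^ α * v t₁ x ^ (-β) * w t₁ x ^ (-γ) ≤
      Real.exp (K * t₁) * ((∫ x in Ω, u 0 x ^ α * v 0 x ^ (-β) * w 0 x ^ (-γ))
        + K * t₁ * volume.real Ω) := by
  have hα := hαβγ.two_lt_α
  have hIoo : Ioo 0 t₁ ×ˢ closure Ω ⊆ Icc 0 t₁ ×ˢ closure Ω := prod_mono_left Ioo_subset_Icc_self
  have hIooΩ : Ioo 0 t₁ ×ˢ Ω ⊆ Icc 0 t₁ ×ˢ closure Ω :=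
    prod_mono Ioo_subset_Icc_self subset_closure
  have hmon : ∀ a b c : ℝ, 0 ≤ a → ContinuousOn (fun p : ℝ × EuclideanSpace ℝ (Fin N) =>
      u p.1 p.2 ^ a * v p.1 p.2 ^ b * w p.1 p.2 ^ c) (Icc 0 t₁ ×ˢ closure Ω) := fun a b c ha =>
    continuousOn_rpow_mul_rpow_mul_rpow hu.continuousOn hv.continuousOn hw.continuousOn
      (fun p hp => ⟨hm.trans_le (hvm _ hp.1 _ hp.2), hm.trans_le (hwm _ hp.1 _ hp.2)⟩) ha b c
  have hpos : ∀ t ∈ Ioo 0 t₁, ∀ x ∈ Ω, 0 < u t x ∧ 0 < v t x ∧ 0 < w t x := fun t ht x hx =>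
    have ht' := Ioo_subset_Icc_self ht
    ⟨hu0 t ht' x hx, hm.trans_le (hvm t ht' x (subset_closure hx)),
      hm.trans_le (hwm t ht' x (subset_closure hx))⟩
  have hE : Continuous fun p : ℝ × EuclideanSpace ℝ (Fin N) => Real.exp (-K * p.1) := by fun_prop
  have hDc : ContinuousOn (fun p : ℝ × EuclideanSpace ℝ (Fin N) => Real.exp (-K * p.1) *
      (u p.1 p.2 ^ α * v p.1 p.2 ^ (-β) * w p.1 p.2 ^ (-γ)) - K * p.1)
      (Icc 0 t₁ ×ˢ closure Ω) :=
    (hE.continuousOn.mul (hmon α (-β) (-γ) (by linarith))).sub (by fun_prop)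
  have key := setIntegral_le_of_deriv_le_divergence hΩ hne ht₁
    (D := fun t x => Real.exp (-K * t) * (u t x ^ α * v t x ^ (-β) * w t x ^ (-γ)) - K * t)
    (D' := fun t x => Real.exp (-K * t) * (u t x ^ α * v t x ^ (-β) * w t x ^ (-γ)) *
      (-K + α * (deriv (fun s => u s x) t / u t x) - β * (deriv (fun s => v s x) t / v t x)
        - γ * (deriv (fun s => w s x) t / w t x)) - K)
    (F := fun t y =>
      (Real.exp (-K * t) * α * P.a₁ * (u t y ^ (α - 1) * v t y ^ (-β) * w t y ^ (-γ))) • G₁ t y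
      + (-(Real.exp (-K * t) * β * P.a₂) *
        (u t y ^ α * v t y ^ (-β - 1) * w t y ^ (-γ))) • G₂ t y
      + (-(Real.exp (-K * t) * γ * P.a₃) *
        (u t y ^ α * v t y ^ (-β) * w t y ^ (-γ - 1))) • G₃ t y)
    hDc ?_ ?_ ?_ ?_ ?_ ?_
  · have hint : ∀ t ∈ Icc 0 t₁,
        IntegrableOn (fun x => u t x ^ α * v t x ^ (-β) * w t x ^ (-γ)) Ω := fun t ht =>
      integrableOn_of_continuousOn_closure hΩ.isBounded
        (continuousOn_slice (f := fun t x => u t x ^ α * v t x ^ (-β) * w t x ^ (-γ))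
          (hmon α (-β) (-γ) (by linarith)) ht)
    have hsplit : ∀ t ∈ Icc 0 t₁,
        ∫ x in Ω, (Real.exp (-K * t) * (u t x ^ α * v t x ^ (-β) * w t x ^ (-γ)) - K * t)
        = Real.exp (-K * t) * (∫ x in Ω, u t x ^ α * v t x ^ (-β) * w t x ^ (-γ))
          - K * t * volume.real Ω := fun t ht => by
      rw [integral_sub ((hint t ht).const_mul _)
        (integrableOn_const hΩ.isBounded.measure_lt_top.ne),
        integral_const_mul, setIntegral_const, smul_eq_mul]
      ring
    rw [hsplit t₁ (right_mem_Icc.2 ht₁.le), hsplit 0 (left_mem_Icc.2 ht₁.le)] at key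
    simp only [mul_zero, Real.exp_zero, one_mul, zero_mul, sub_zero] at key
    have h1 : Real.exp (K * t₁) * Real.exp (-K * t₁) = 1 := by rw [← Real.exp_add]; simp
    calc ∫ x in Ω, u t₁ x ^ α * v t₁ x ^ (-β) * w t₁ x ^ (-γ)
        = Real.exp (K * t₁) * (Real.exp (-K * t₁) *
          ∫ x in Ω, u t₁ x ^ α * v t₁ x ^ (-β) * w t₁ x ^ (-γ)) := by
          rw [← mul_assoc, h1, one_mul]
      _ ≤ _ := by gcongr; linarith
  · intro t ht x hx
    obtain ⟨pu, pv, pw⟩ := hpos t ht x hx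
    have h1 := (hasFDerivAt_rpow_mul_rpow_mul_rpow (hu.hasDerivAt t ht x hx).hasFDerivAt
      (hv.hasDerivAt t ht x hx).hasFDerivAt (hw.hasDerivAt t ht x hx).hasFDerivAt pu pv pw
      α (-β) (-γ)).hasDerivAt
    have h2 : HasDerivAt (fun s => Real.exp (-K * s)) (Real.exp (-K * t) * (-K)) t := by
      simpa using ((hasDerivAt_id t).const_mul (-K)).exp
    have h3 : HasDerivAt (fun s => K * s) K t := by simpa using (hasDerivAt_id t).const_mul K
    refine ((h2.mul h1).sub h3).congr_deriv ?_
    simp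
    ring
  · have hmon' := (hmon α (-β) (-γ) (by linarith)).mono hIooΩ
    have p := fun (p : ℝ × EuclideanSpace ℝ (Fin N)) (hp : p ∈ Ioo 0 t₁ ×ˢ Ω) =>
      hpos p.1 hp.1 p.2 hp.2
    exact ((hE.continuousOn.mul hmon').mul (((continuousOn_const.add (continuousOn_const.mul
      (hu.continuousOn_deriv.div (hu.continuousOn.mono hIooΩ) fun q hq => (p q hq).1.ne'))).sub
      (continuousOn_const.mul
      (hv.continuousOn_deriv.div (hv.continuousOn.mono hIooΩ) fun q hq => (p q hq).2.1.ne'))).sub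
      (continuousOn_const.mul (hw.continuousOn_deriv.div (hw.continuousOn.mono hIooΩ)
        fun q hq => (p q hq).2.2.ne')))).sub continuousOn_const
  · have h1 := (hmon (α - 1) (-β) (-γ) (by linarith)).mono hIoo
    have h2 := (hmon α (-β - 1) (-γ) (by linarith)).mono hIoo
    have h3 := (hmon α (-β) (-γ - 1) (by linarith)).mono hIoo
    exact (((((hE.continuousOn.mul continuousOn_const).mul continuousOn_const).mul h1).smul
      hu.continuousOn_grad).add ((((hE.continuousOn.mul continuousOn_const).mul
      continuousOn_const).neg.mul h2).smul hv.continuousOn_grad)).add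
      ((((hE.continuousOn.mul continuousOn_const).mul
      continuousOn_const).neg.mul h3).smul hw.continuousOn_grad)
  · intro t ht
    have hmon' : ∀ a b c k : ℝ, ContDiffOn ℝ 1
        (fun y => k * (u t y ^ a * v t y ^ b * w t y ^ c)) Ω := fun a b c k =>
      contDiffOn_const.mul (contDiffOn_rpow_mul_rpow_mul_rpow
        ((hu.contDiffOn t ht).of_le (by norm_num)) ((hv.contDiffOn t ht).of_le (by norm_num))
        ((hw.contDiffOn t ht).of_le (by norm_num)) (hpos t ht) a b c)
    exact (((hmon' _ _ _ _).smul (hu.contDiffOn_grad hΩ.isOpen ht)).add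
      ((hmon' _ _ _ _).smul (hv.contDiffOn_grad hΩ.isOpen ht))).add
      ((hmon' _ _ _ _).smul (hw.contDiffOn_grad hΩ.isOpen ht))
  · intro t ht y η hη
    simp only [inner_add_left, inner_smul_left, hu.grad_normal t ht y η hη,
      hv.grad_normal t ht y η hη, hw.grad_normal t ht y η hη, mul_zero, add_zero]
  · intro t ht x hx
    obtain ⟨pu, pv, pw⟩ := hpos t ht x hx
    have ht' := Ioo_subset_Icc_self ht
    have hE0 := Real.exp_pos (-K * t)
    have hE1 : Real.exp (-K * t) ≤ 1 := Real.exp_le_one_iff.2 (by nlinarith [ht.1])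
    refine le_trans ?_ (diffusion_le_divergence hΩ.isOpen hP hαβγ hu hv hw ht hx pu pv pw hE0.le)
    have hr := mul_le_mul_of_nonneg_left (hK (u t x) (v t x) (w t x) pu
      (hvm t ht' x (subset_closure hx)) (hwm t ht' x (subset_closure hx))) hE0.le
    rw [← equ t ht x hx, ← eqv t ht x hx, ← eqw t ht x hx] at hr
    simp only [sub_div] at hr
    have hKE : Real.exp (-K * t) * K ≤ K := mul_le_of_le_one_left hK0 hE1
    linarith

/-- The bound for one solution. Its right-hand side involves the solution neither directly nor
through `m` and `K`, and it increases with `t`. -/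
theorem IsPositiveClassicalSolution.L_le (hΩ : IsBoundedC1Domain Ω) (hne : Ωᶜ.Nonempty)
    {P : Params} (hP : P.Admissible) {α β γ : ℝ} (hαβγ : WeightCondition P α β γ)
    {φ₁ φ₂ φ₃ : EuclideanSpace ℝ (Fin N) → ℝ} {T : EReal} {Tstar m K : ℝ}
    (hm : 0 < m) (hφ₂ : ∀ x ∈ Ω, m ≤ φ₂ x) (hφ₃ : ∀ x ∈ Ω, m ≤ φ₃ x) (hK0 : 0 ≤ K)
    (hK : ∀ u v w : ℝ, 0 < u → m * Real.exp (-(P.b₂ + P.b₃) * Tstar) ≤ v →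
      m * Real.exp (-(P.b₂ + P.b₃) * Tstar) ≤ w → u ^ α * v ^ (-β) * w ^ (-γ) *
        (α * (P.f u v w / u) - β * (P.g u v w / v) - γ * (P.h u v w / w)) ≤
      K * (u ^ α * v ^ (-β) * w ^ (-γ)) + K)
    {u v w : ℝ → EuclideanSpace ℝ (Fin N) → ℝ}
    (h : IsPositiveClassicalSolution P Ω φ₁ φ₂ φ₃ T u v w) {t : ℝ} (ht0 : 0 ≤ t)
    (htT : t ≤ Tstar) (ht : (t : EReal) < T) :
    IntegrableOn (density α β γ u v w t) Ω ∧ L Ω α β γ u v w t ≤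
      Real.exp (K * t) * ((∫ x in Ω, φ₁ x ^ α * φ₂ x ^ (-β) * φ₃ x ^ (-γ))
        + K * t * volume.real Ω) := by
  obtain ⟨hb₁, hb₂, hb₃⟩ := hP.b_pos
  obtain ⟨ha₁, ha₂, ha₃⟩ := hP.a_pos
  have hα := hαβγ.two_lt_α
  obtain ⟨G₁, hG₁⟩ := h.regular.1.exists_isNeumannRegular h.neumann.1
  obtain ⟨G₂, hG₂⟩ := h.regular.2.1.exists_isNeumannRegular h.neumann.2.1
  obtain ⟨G₃, hG₃⟩ := h.regular.2.2.exists_isNeumannRegular h.neumann.2.2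
  have hlt : ∀ s ≤ t, (s : EReal) < T := fun s hs => (EReal.coe_le_coe_iff.2 hs).trans_lt ht
  have hpos : ∀ s ∈ Icc 0 t, ∀ x ∈ Ω, 0 < u s x ∧ 0 < v s x ∧ 0 < w s x := fun s hs =>
    h.pos s hs.1 (hlt s hs.2)
  -- The bounds hold up to the boundary, where positivity is not part of the hypotheses. The rate
  -- `b₂ + b₃` serves for `v` and `w` alike.
  have hlow : ∀ (z : ℝ → EuclideanSpace ℝ (Fin N) → ℝ)
      (G : ℝ → EuclideanSpace ℝ (Fin N) → EuclideanSpace ℝ (Fin N)) (a b : ℝ), 0 < a → 0 < b →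
      b ≤ P.b₂ + P.b₃ → (∀ s : ℝ, (s : EReal) < T → IsNeumannRegular Ω s z G) →
      (∀ x ∈ Ω, m ≤ z 0 x) →
      (∀ s ∈ Ioc 0 t, ∀ x ∈ Ω,
        0 ≤ deriv (fun r => z r x) s - a * Laplacian.laplacian (z s) x + b * z s x) →
      ∀ s ∈ Icc 0 t, ∀ x ∈ closure Ω, m * Real.exp (-(P.b₂ + P.b₃) * Tstar) ≤ z s x := by
    intro z G a b ha hb hbb hz hz0 hsup s hs x hx
    have hdecay : m * Real.exp (-(P.b₂ + P.b₃) * Tstar) ≤ m * Real.exp (-b * s) := by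
      have := mul_le_mul hbb (hs.2.trans htT) hs.1 (by linarith)
      exact mul_le_mul_of_nonneg_left (Real.exp_le_exp.2 (by linarith)) hm.le
    refine hdecay.trans ?_
    rcases hs.1.eq_or_lt with h0 | h0
    · subst h0
      simp only [mul_zero, Real.exp_zero, mul_one]
      exact le_on_closure hz0 continuousOn_const (continuousOn_slice
        (hz t ht).continuousOn (left_mem_Icc.2 ht0)) hx
    · exact (hz s (hlt s hs.2)).mul_exp_le hΩ hne h0 ha hz0
        (fun r hr => hsup r ⟨hr.1, hr.2.le.trans hs.2⟩) x hx
  have hvm := hlow v G₂ P.a₂ P.b₂ ha₂ hb₂ (by linarith) hG₂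
    (fun x hx => by rw [(h.initial x hx).2.1]; exact hφ₂ x hx) (fun s hs x hx => by
      obtain ⟨pu, pv, pw⟩ := hpos s ⟨hs.1.le, hs.2⟩ x hx
      rw [h.eq_v s hs.1 (hlt s hs.2) x hx, Params.g, neg_mul, neg_add_cancel_comm]
      positivity)
  have hwm := hlow w G₃ P.a₃ P.b₃ ha₃ hb₃ (by linarith) hG₃
    (fun x hx => by rw [(h.initial x hx).2.2]; exact hφ₃ x hx) (fun s hs x hx => by
      obtain ⟨pu, pv, pw⟩ := hpos s ⟨hs.1.le, hs.2⟩ x hx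
      rw [h.eq_w s hs.1 (hlt s hs.2) x hx, Params.h, neg_mul, neg_add_cancel_comm]
      positivity)
  have hm' : 0 < m * Real.exp (-(P.b₂ + P.b₃) * Tstar) := by positivity
  have hdens : EqOn (density α β γ u v w t)
      (fun x => u t x ^ α * v t x ^ (-β) * w t x ^ (-γ)) Ω := fun x hx =>
    have hp := hpos t (right_mem_Icc.2 ht0) x hx
    density_eq α β γ hp.2.1.le hp.2.2.le
  have hinit : ∫ x in Ω, u 0 x ^ α * v 0 x ^ (-β) * w 0 x ^ (-γ)
      = ∫ x in Ω, φ₁ x ^ α * φ₂ x ^ (-β) * φ₃ x ^ (-γ) :=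
    setIntegral_congr_fun hΩ.isOpen.measurableSet fun x hx => by
      obtain ⟨e1, e2, e3⟩ := h.initial x hx
      simp only [e1, e2, e3]
  have hslice : ∀ {z : ℝ → EuclideanSpace ℝ (Fin N) → ℝ}
      {G : ℝ → EuclideanSpace ℝ (Fin N) → EuclideanSpace ℝ (Fin N)},
      IsNeumannRegular Ω t z G → ContinuousOn (z t) (closure Ω) := fun hz =>
    continuousOn_slice hz.continuousOn (right_mem_Icc.2 ht0)
  refine ⟨?_, ?_⟩
  · rw [integrableOn_congr_fun hdens hΩ.isOpen.measurableSet]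
    refine integrableOn_of_continuousOn_closure hΩ.isBounded
      (continuousOn_rpow_mul_rpow_mul_rpow (hslice (hG₁ t ht)) (hslice (hG₂ t ht))
        (hslice (hG₃ t ht)) (fun x hx => ⟨?_, ?_⟩) (by linarith) _ _)
    · exact hm'.trans_le (hvm t (right_mem_Icc.2 ht0) x hx)
    · exact hm'.trans_le (hwm t (right_mem_Icc.2 ht0) x hx)
  · rw [L, setIntegral_congr_fun hΩ.isOpen.measurableSet hdens, ← hinit]
    rcases ht0.eq_or_lt with h0 | h0
    · subst h0; simp
    · exact setIntegral_weighted_le hΩ hne hP hαβγ h0 hm' hK0 hK (hG₁ t ht) (hG₂ t ht) (hG₃ t ht)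
        (fun s hs x hx => (hpos s hs x hx).1) hvm hwm
        (fun s hs => h.eq_u s hs.1 (hlt s hs.2.le)) (fun s hs => h.eq_v s hs.1 (hlt s hs.2.le))
        (fun s hs => h.eq_w s hs.1 (hlt s hs.2.le))

theorem IsBoundedC1Domain.exists_pos_le (hΩ : IsBoundedC1Domain Ω)
    {φ : EuclideanSpace ℝ (Fin N) → ℝ} (hφ : ContinuousOn φ (closure Ω))
    (hpos : ∀ x ∈ closure Ω, 0 < φ x) : ∃ m, 0 < m ∧ ∀ x ∈ Ω, m ≤ φ x := by
  obtain ⟨x₀, hx₀, hmin⟩ := (Metric.isCompact_of_isClosed_isBounded isClosed_closure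
    hΩ.isBounded.closure).exists_isMinOn hΩ.isConnected.nonempty.closure hφ
  exact ⟨φ x₀, hpos x₀ hx₀, fun x hx => hmin (subset_closure hx)⟩

theorem nonempty_compl_of_isBounded (hN : 0 < N) (hb : Bornology.IsBounded Ω) :
    Ωᶜ.Nonempty := by
  have : Nonempty (Fin N) := ⟨⟨0, hN⟩⟩
  rw [nonempty_compl]
  rintro rfl
  exact NormedSpace.unbounded_univ ℝ (EuclideanSpace ℝ (Fin N)) hb

end GiererMeinhardt

end

/-- The bound `κ` depends only on the domain, the coefficients and exponents, the initial data and
`Tstar`, not on the solution. For `Tstar < Tmax` it bounds `L` on all of `[0, Tstar]`; if `Tmax` is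
finite, `Tstar = Tmax` gives one bound on `[0, Tmax)`. -/
theorem theorem1 {N : ℕ} (hN : 0 < N) (Ω : Set (EuclideanSpace ℝ (Fin N)))
    (hΩ : GiererMeinhardt.IsBoundedC1Domain Ω)
    (P : GiererMeinhardt.Params) (hP : P.Admissible) (hexp : P.ExponentCondition)
    (α β γ : ℝ) (hαβγ : GiererMeinhardt.WeightCondition P α β γ)
    (φ₁ φ₂ φ₃ : EuclideanSpace ℝ (Fin N) → ℝ)
    (hφc : ContinuousOn φ₁ (closure Ω) ∧ ContinuousOn φ₂ (closure Ω) ∧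
      ContinuousOn φ₃ (closure Ω))
    (hφpos : ∀ x ∈ closure Ω, 0 < φ₁ x ∧ 0 < φ₂ x ∧ 0 < φ₃ x)
    (Tstar : ℝ) :
    ∃ κ : ℝ, ∀ (Tmax : EReal) (u v w : ℝ → EuclideanSpace ℝ (Fin N) → ℝ),
      GiererMeinhardt.IsPositiveClassicalSolution P Ω φ₁ φ₂ φ₃ Tmax u v w →
      ∀ t : ℝ, 0 ≤ t → t ≤ Tstar → (t : EReal) < Tmax →
        IntegrableOn (GiererMeinhardt.density α β γ u v w t) Ω ∧
        0 ≤ GiererMeinhardt.L Ω α β γ u v w t ∧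
        GiererMeinhardt.L Ω α β γ u v w t ≤ κ := by
  have hne := GiererMeinhardt.nonempty_compl_of_isBounded hN hΩ.isBounded
  obtain ⟨m₂, hm₂, hφ₂⟩ := hΩ.exists_pos_le hφc.2.1 fun x hx => (hφpos x hx).2.1
  obtain ⟨m₃, hm₃, hφ₃⟩ := hΩ.exists_pos_le hφc.2.2 fun x hx => (hφpos x hx).2.2
  have hm : 0 < min m₂ m₃ := lt_min hm₂ hm₃
  have hα := hαβγ.two_lt_α
  obtain ⟨K, hK0, hK⟩ := GiererMeinhardt.exists_reaction_le hP hexp (α := α) (by linarith)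
    hαβγ.β_pos hαβγ.γ_pos
    (show 0 < min m₂ m₃ * Real.exp (-(P.b₂ + P.b₃) * Tstar) by positivity)
  have hI : 0 ≤ ∫ x in Ω, φ₁ x ^ α * φ₂ x ^ (-β) * φ₃ x ^ (-γ) :=
    setIntegral_nonneg hΩ.isOpen.measurableSet fun x hx => by
      obtain ⟨h1, h2, h3⟩ := hφpos x (subset_closure hx)
      positivity
  refine ⟨Real.exp (K * Tstar) * ((∫ x in Ω, φ₁ x ^ α * φ₂ x ^ (-β) * φ₃ x ^ (-γ))
    + K * Tstar * volume.real Ω), fun Tmax u v w h t ht0 htT ht => ?_⟩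
  obtain ⟨hint, hle⟩ := h.L_le hΩ hne hP hαβγ hm
    (fun x hx => (min_le_left _ _).trans (hφ₂ x hx))
    (fun x hx => (min_le_right _ _).trans (hφ₃ x hx)) hK0 hK ht0 htT ht
  refine ⟨hint, ?_, hle.trans ?_⟩
  · refine setIntegral_nonneg hΩ.isOpen.measurableSet fun x hx => ?_
    obtain ⟨h1, h2, h3⟩ := h.pos t ht0 ht x hx
    unfold GiererMeinhardt.density
    positivity
  · gcongr
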